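/- Let $T\subset\mathbb R^3$ be a (non-degenerate) tetrahedron and let $o$ be a point in its interior (for instance, its centre of mass); let $r$ be the distance from $o$. A point $x\in T$ is an *equilibrium point* if the plane $H$ through $x$ perpendicular to the segment $[o,x]$ supports $T$ at $x$; it is *non-degenerate* if $H\cap T$ is the face, edge or vertex that contains $x$ in its relative interior, and then $x$ is called *stable*, a *saddle*, or *unstable*, respectively. Assume that $r$ is polyhedral Morse, i.e. that all equilibrium points are non-degenerate, and that $T$ is not monostatic (with respect to $o$), i.e. that it has neither exactly one stable nor exactly one unstable equilibrium point. For a boundary point $p$ and a face or edge $F$ containing $p$, let $g_F(p)$ be the gradient at $p$ of $r$ restricted to the plane or line spanned by $F$; it is a *candidate gradient* at $p$ if it points from $p$ into $F$. The *extended gradient* at $p$ is the non-zero candidate gradient of maximal length, if there is a non-zero candidate. An *ascending curve* from an equilibrium point $x$ (its origin) to an equilibrium point $y$ (its destination) is a continuous curve that tends to $x$ backwards in time, ends at $y$, contains $y$ but not $x$, and whose right-hand derivative at every point other than $y$ is the extended gradient. Ascending curves are identified with their point sets; an ascending curve is *isolated* unless it runs from a stable to an unstable point. The isolated ascending curves are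 the edges of the Morse–Smale graph of $r$, whose vertices are the equilibrium points. Then the Morse–Smale graph has no parallel isolated ascending curves: 1. for every saddle $h$ and every unstable point $u$ there is at most one isolated ascending curve from $h$ to $u$; 2. for every stable point $s$ and every saddle $h$ there is at most one isolated ascending curve from $s$ to $h$ that does not pass through a vertex of $T$. (In general position no ascending curve that ends at a saddle passes through a vertex, and the restriction in 2 is void. If such a curve passes through a vertex, infinitely many ascending curves may merge on their way to the saddle.) -/

import Mathlib

/-- Euclidean three-space. -/
abbrev E3 : Type := EuclideanSpace ℝ (Fin 3)

/-- A tetrahedron is given by its four affinely independent vertices. -/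
abbrev Tetrahedron : Type := Affine.Simplex ℝ E3 3

namespace Tetrahedron

/-- The solid tetrahedron. -/
def body (T : Tetrahedron) : Set E3 := convexHull ℝ (Set.range T.points)

/-- The closed face of `T` spanned by the vertices with index in `s`: a vertex, an edge, or a
(two-dimensional) face if `s` has 1, 2, or 3 elements. -/
def closedFace (T : Tetrahedron) (s : Finset (Fin 4)) : Set E3 :=
  convexHull ℝ (T.points '' (s : Set (Fin 4)))

/-- The relative interior of `closedFace T s`. -/
def openFace (T : Tetrahedron) (s : Finset (Fin 4)) : Set E3 :=
  {x | ∃ w : Fin 4 → ℝ, (∀ i ∈ s, 0 < w i) ∧ (∀ i ∉ s, w i = 0) ∧ ∑ i, w i = 1 ∧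
    x = ∑ i, w i • T.points i}

/-- The part of the solid tetrahedron in the plane through `x` perpendicular to the segment
from `o` to `x`. -/
def contactSet (T : Tetrahedron) (o x : E3) : Set E3 :=
  {y | y ∈ T.body ∧ inner ℝ (y - x) (x - o) = 0}

/-- `x` is an equilibrium point with respect to `o`: the plane through `x` perpendicular to the
segment from `o` to `x` supports `T` at `x`. -/
def IsEquilibrium (T : Tetrahedron) (o x : E3) : Prop :=
  x ∈ T.body ∧ x ≠ o ∧ ∀ y ∈ T.body, inner ℝ (y - x) (x - o) ≤ 0

/-- `x` is a non-degenerate equilibrium point carried by the face `s`: `x` lies in the relative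
interior of the face, and the supporting plane meets `T` in exactly this face. -/
def IsNondegenerateOn (T : Tetrahedron) (o x : E3) (s : Finset (Fin 4)) : Prop :=
  T.IsEquilibrium o x ∧ x ∈ T.openFace s ∧ T.contactSet o x = T.closedFace s

/-- Stable equilibrium point: a non-degenerate equilibrium inside a two-dimensional face. -/
def IsStable (T : Tetrahedron) (o x : E3) : Prop :=
  ∃ s : Finset (Fin 4), s.card = 3 ∧ T.IsNondegenerateOn o x s

/-- Saddle: a non-degenerate equilibrium inside an edge. -/
def IsSaddle (T : Tetrahedron) (o x : E3) : Prop :=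
  ∃ s : Finset (Fin 4), s.card = 2 ∧ T.IsNondegenerateOn o x s

/-- Unstable equilibrium point: a non-degenerate equilibrium at a vertex. -/
def IsUnstable (T : Tetrahedron) (o x : E3) : Prop :=
  ∃ s : Finset (Fin 4), s.card = 1 ∧ T.IsNondegenerateOn o x s

/-- The radial distance function from `o` is polyhedral Morse: all its equilibrium points are
non-degenerate. -/
def IsPolyhedralMorse (T : Tetrahedron) (o : E3) : Prop :=
  ∀ x, T.IsEquilibrium o x → ∃ s : Finset (Fin 4), T.IsNondegenerateOn o x s

/-- Monostatic: there is only one stable or only one unstable equilibrium point. -/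
def IsMonostatic (T : Tetrahedron) (o : E3) : Prop :=
  (∃! x, T.IsStable o x) ∨ (∃! x, T.IsUnstable o x)

/-- The gradient at `p` of the distance from `o`, restricted to the line or plane spanned by the
edge or face `s`: the orthogonal projection of the unit vector from `o` towards `p`. -/
noncomputable def faceGradient (T : Tetrahedron) (o : E3) (s : Finset (Fin 4)) (p : E3) : E3 :=
  (vectorSpan ℝ (T.points '' (s : Set (Fin 4)))).starProjection ((dist p o)⁻¹ • (p - o))

/-- `v` is a candidate gradient at `p`: it is the gradient along some edge or face that
contains `p`, and it is tangential to `T`, that is, it points from `p` into that edge or face. -/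
def IsCandidateGradient (T : Tetrahedron) (o p v : E3) : Prop :=
  ∃ s : Finset (Fin 4), (s.card = 2 ∨ s.card = 3) ∧ p ∈ T.closedFace s ∧
    v = T.faceGradient o s p ∧ ∃ ε : ℝ, 0 < ε ∧ p + ε • v ∈ T.closedFace s

/-- `v` is the extended gradient at the regular point `p`: a non-zero candidate gradient of
maximal length. -/
def IsExtendedGradient (T : Tetrahedron) (o p v : E3) : Prop :=
  v ≠ 0 ∧ T.IsCandidateGradient o p v ∧ ∀ w, T.IsCandidateGradient o p w → ‖w‖ ≤ ‖v‖

/-- `C` is (the trace of) an ascending curve with origin `x` and destination `y`, both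
equilibrium points: a continuous curve on an interval `I`, normalised to end at time `0`, whose
right-hand derivative is the extended gradient at all times before `0`, which tends to `x` at the
lower end of `I` and is at `y` at time `0`. As there is no extended gradient at equilibrium
points, such a curve cannot be prolonged in either direction. The lower end of `I` may be finite
or `-∞`; the curve contains its destination but not its origin. -/
def IsAscendingCurve (T : Tetrahedron) (o x y : E3) (C : Set E3) : Prop :=
  T.IsEquilibrium o x ∧ T.IsEquilibrium o y ∧
  ∃ (I : Set ℝ) (γ : ℝ → E3),
    I.OrdConnected ∧ IsGreatest I 0 ∧ (∃ t ∈ I, t < 0) ∧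
    ContinuousOn γ I ∧
    (∀ t ∈ I, t < 0 → ∃ v, T.IsExtendedGradient o (γ t) v ∧
      HasDerivWithinAt γ v (Set.Ici t) t) ∧
    (∀ ε : ℝ, 0 < ε → ∃ t₀ ∈ I, ∀ t ∈ I, t ≤ t₀ → dist (γ t) x < ε) ∧
    γ 0 = y ∧
    C = γ '' I

/-- An ascending curve is isolated unless it runs from a stable to an unstable point. The
isolated ascending curves are the edges of the Morse-Smale graph, whose vertices are the
equilibrium points. -/
def IsIsolatedAscendingCurve (T : Tetrahedron) (o x y : E3) (C : Set E3) : Prop :=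
  T.IsAscendingCurve o x y C ∧ ¬ (T.IsStable o x ∧ T.IsUnstable o y)

end Tetrahedron

/-!
The extended gradient at a boundary point `p` is the projection of the unit vector from `o`
towards `p` onto the tangent cone of `T` at `p` (`IsExtendedGradient.isResidualNormal`): the
residual is an outer normal of `T`. Outer normals of a convex body are monotone, so a Grönwall
estimate makes the ascending flow unique forwards in time, and, more generally, no ascending curve
leaves a compact set into which the field points (`IsTrap.mem`). In the interior of a face the flow
runs along rays from the foot of the perpendicular from `o`. A trajectory traced backwards in the
interior of a face is therefore determined until it meets the boundary of this face, and if it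
meets the interior of an edge there, it comes from the face beyond this edge
(`BackPath.unique`, `IsCurveFrom.exists_backPath`).

*From a saddle to a vertex.* A curve that leaves a saddle starts inside the edge of the saddle,
towards one of its two ends. Two curves that start towards the same end and have the same
destination coincide by forward uniqueness. If they start towards different ends, each of them
is confined to a trap that consists of segments, and so each of the two ends of the edge is
connected to the destination by a chain of vertices along which the distance from `o` grows on the
connecting edges (`exists_trap_of_vertex`).

*From a face to a saddle.* A curve that reaches a saddle comes out of the interior of one of the
two adjacent faces. Two curves out of the same face coincide by backward uniqueness. If they come
out of different faces, each of these faces is connected to the face of the origin by a chain of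
faces such that the foot of each face lies beyond the plane of the next one.

Both kinds of chains are of the same form, `Leads`: in the first case for the vertices of `T`, in
the second case for the vertices of the polar tetrahedron, where the saddle edge is replaced by its
dual edge. The first steps of two chains from the ends of a saddle edge move to opposite sides of
the plane through `o` perpendicular to this edge, so they go to different vertices. Hence two chains
with the same end `u` meet all four vertices (this remains true if one of the chains is trivial),
every vertex but `u` leads to another one (`exists_leads_of_chains`), and `u` is the only unstable
vertex, respectively the only stable face: `T` is monostatic.
-/

namespace Tetrahedron

/-! ### Barycentric coordinates -/

/-- The vertices of `T` as an affine basis of space. -/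
noncomputable def affineBasis (T : Tetrahedron) : AffineBasis (Fin 4) ℝ E3 :=
  ⟨T.points, T.independent, by
    rw [T.independent.affineSpan_eq_top_iff_card_eq_finrank_add_one]; simp⟩

/-- The barycentric coordinate belonging to vertex `i`; it vanishes on the opposite face. -/
noncomputable def coord (T : Tetrahedron) (i : Fin 4) (x : E3) : ℝ := T.affineBasis.coord i x

/-- The gradient of the `i`-th barycentric coordinate. -/
noncomputable def coordGrad (T : Tetrahedron) (i : Fin 4) : E3 :=
  (InnerProductSpace.toDual ℝ E3).symm
    (LinearMap.toContinuousLinearMap (T.affineBasis.coord i).linear)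

variable (T : Tetrahedron) (o : E3)

lemma coord_eq_add_inner (i : Fin 4) (x y : E3) :
    T.coord i x = T.coord i y + inner ℝ (T.coordGrad i) (x - y) := by
  have h := (T.affineBasis.coord i).linearMap_vsub x y
  simp only [vsub_eq_sub] at h
  rw [coordGrad, InnerProductSpace.toDual_symm_apply, LinearMap.coe_toContinuousLinearMap', h, coord,
    coord]
  ring

lemma coord_add (i : Fin 4) (x u : E3) :
    T.coord i (x + u) = T.coord i x + inner ℝ (T.coordGrad i) u := by
  rw [T.coord_eq_add_inner i (x + u) x, add_sub_cancel_left]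

lemma inner_coordGrad_sub (i : Fin 4) (x y : E3) :
    inner ℝ (T.coordGrad i) (x - y) = T.coord i x - T.coord i y := by
  rw [T.coord_eq_add_inner i x y]; ring

lemma continuous_coord (i : Fin 4) : Continuous (T.coord i) := by
  have : T.coord i = fun x => T.coord i 0 + inner ℝ (T.coordGrad i) x := by
    ext x; simpa using T.coord_eq_add_inner i x 0
  rw [this]; fun_prop

lemma coord_point (i j : Fin 4) : T.coord i (T.points j) = if i = j then 1 else 0 :=
  T.affineBasis.coord_apply i j

@[simp] lemma coord_point_self (i : Fin 4) : T.coord i (T.points i) = 1 := by simp [coord_point]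

lemma coord_point_of_ne {i j : Fin 4} (h : i ≠ j) : T.coord i (T.points j) = 0 := by
  simp [coord_point, h]

lemma sum_coord (x : E3) : ∑ i, T.coord i x = 1 := T.affineBasis.sum_coord_apply_eq_one x

lemma sum_coord_smul (x : E3) : ∑ i, T.coord i x • T.points i = x :=
  T.affineBasis.linear_combination_coord_eq_self x

lemma coord_sum_smul (w : Fin 4 → ℝ) (hw : ∑ i, w i = 1) (i : Fin 4) :
    T.coord i (∑ j, w j • T.points j) = w i := by
  have := T.affineBasis.coord_apply_combination_of_mem (s := Finset.univ) (Finset.mem_univ i) hw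
  rwa [Finset.affineCombination_eq_linear_combination _ _ _ hw] at this

lemma eq_of_coord_eq {x y : E3} (h : ∀ i, T.coord i x = T.coord i y) : x = y := by
  rw [← T.sum_coord_smul x, ← T.sum_coord_smul y]; simp [h]

/-- A linear functional is recovered from its values at the vertices. -/
lemma inner_sub_eq_sum (κ x y : E3) :
    inner ℝ κ (x - y) = ∑ i, T.coord i x * inner ℝ κ (T.points i - y) := by
  have : x - y = ∑ i, T.coord i x • (T.points i - y) := by
    simp only [smul_sub, Finset.sum_sub_distrib, ← Finset.sum_smul, sum_coord, one_smul,
      sum_coord_smul]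
  conv_lhs => rw [this]
  simp [inner_sum, inner_smul_right]

lemma sum_inner_coordGrad (u : E3) : ∑ i, inner ℝ (T.coordGrad i) u = 0 := by
  have h : ∀ i, inner ℝ (T.coordGrad i) u = T.coord i u - T.coord i 0 := fun i => by
    rw [← inner_coordGrad_sub, sub_zero]
  simp [h, Finset.sum_sub_distrib, sum_coord]

lemma sum_inner_coordGrad_smul (y u : E3) :
    ∑ i, inner ℝ (T.coordGrad i) u • (T.points i - y) = u := by
  have h : ∀ i, inner ℝ (T.coordGrad i) u = T.coord i u - T.coord i 0 := fun i => by
    rw [← inner_coordGrad_sub, sub_zero]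
  rw [show (∑ i, inner ℝ (T.coordGrad i) u • (T.points i - y))
    = (∑ i, inner ℝ (T.coordGrad i) u • T.points i) - (∑ i, inner ℝ (T.coordGrad i) u) • y by
      simp [smul_sub, Finset.sum_sub_distrib, Finset.sum_smul]]
  rw [sum_inner_coordGrad, zero_smul, sub_zero]
  simp [h, sub_smul, Finset.sum_sub_distrib, sum_coord_smul]

/-- The gradients of the barycentric coordinates and the vertices are dual to each other. -/
lemma sum_inner_smul_coordGrad (κ y : E3) :
    ∑ i, inner ℝ κ (T.points i - y) • T.coordGrad i = κ := by
  refine ext_inner_right ℝ fun u => ?_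
  conv_rhs => rw [← T.sum_inner_coordGrad_smul y u]
  simp only [sum_inner, inner_sum, inner_smul_left, inner_smul_right]
  exact Finset.sum_congr rfl fun i _ => by simp [mul_comm]

lemma mem_body_iff {x : E3} : x ∈ T.body ↔ ∀ i, 0 ≤ T.coord i x := by
  have := T.affineBasis.convexHull_eq_nonneg_coord
  exact Set.ext_iff.1 this x

lemma convex_body : Convex ℝ T.body := convex_convexHull ℝ _

lemma point_mem_body (i : Fin 4) : T.points i ∈ T.body :=
  subset_convexHull ℝ _ (Set.mem_range_self i)

lemma coord_pos_of_mem_interior {x : E3} (hx : x ∈ interior T.body) (i : Fin 4) :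
    0 < T.coord i x := by
  have := T.affineBasis.interior_convexHull
  exact (Set.ext_iff.1 this x).1 hx i

lemma mem_closedFace_iff {s : Finset (Fin 4)} {x : E3} :
    x ∈ T.closedFace s ↔ (∀ i, 0 ≤ T.coord i x) ∧ ∀ i ∉ s, T.coord i x = 0 := by
  constructor
  · intro hx
    have hc : Convex ℝ {x : E3 | (∀ i, 0 ≤ T.coord i x) ∧ ∀ i ∉ s, T.coord i x = 0} := by
      intro x hx y hy a b ha hb hab
      have key : ∀ i, T.coord i (a • x + b • y) = a * T.coord i x + b * T.coord i y := by
        intro i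
        rw [T.coord_eq_add_inner i _ y, show a • x + b • y - y = a • (x - y) by
          rw [show b = 1 - a by linarith]; module, inner_smul_right, inner_coordGrad_sub]
        rw [show b = 1 - a by linarith]; ring
      refine ⟨fun i => ?_, fun i hi => ?_⟩
      · rw [key]; have := hx.1 i; have := hy.1 i; positivity
      · rw [key, hx.2 i hi, hy.2 i hi]; ring
    refine convexHull_min ?_ hc hx
    rintro _ ⟨j, hj, rfl⟩
    refine ⟨fun i => ?_, fun i hi => ?_⟩
    · rw [coord_point]; split_ifs <;> norm_num
    · exact T.coord_point_of_ne fun h => hi (h ▸ hj)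
  · rintro ⟨h0, h1⟩
    have hsum : ∑ i ∈ s, T.coord i x = 1 := by
      rw [← T.sum_coord x]
      exact Finset.sum_subset (Finset.subset_univ s) fun i _ hi => h1 i hi
    have hx : x = ∑ i ∈ s, T.coord i x • T.points i := by
      conv_lhs => rw [← T.sum_coord_smul x]
      symm
      exact Finset.sum_subset (Finset.subset_univ s) fun i _ hi => by rw [h1 i hi, zero_smul]
    rw [hx]
    exact (convex_convexHull ℝ _).sum_mem (fun i _ => h0 i) hsum
      fun i hi => subset_convexHull ℝ _ ⟨i, hi, rfl⟩

lemma mem_openFace_iff {s : Finset (Fin 4)} {x : E3} :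
    x ∈ T.openFace s ↔ (∀ i ∈ s, 0 < T.coord i x) ∧ ∀ i ∉ s, T.coord i x = 0 := by
  constructor
  · rintro ⟨w, h0, h1, h2, rfl⟩
    simp only [T.coord_sum_smul w h2]
    exact ⟨h0, h1⟩
  · rintro ⟨h0, h1⟩
    exact ⟨fun i => T.coord i x, h0, h1, T.sum_coord x, (T.sum_coord_smul x).symm⟩

lemma closedFace_subset_body (s : Finset (Fin 4)) : T.closedFace s ⊆ T.body := fun _ hx =>
  T.mem_body_iff.2 (T.mem_closedFace_iff.1 hx).1

lemma point_mem_closedFace {s : Finset (Fin 4)} {i : Fin 4} (hi : i ∈ s) :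
    T.points i ∈ T.closedFace s := subset_convexHull ℝ _ ⟨i, hi, rfl⟩

lemma mem_vectorSpan_iff {s : Finset (Fin 4)} (hs : s.Nonempty) {u : E3} :
    u ∈ vectorSpan ℝ (T.points '' (s : Set (Fin 4))) ↔
      ∀ i ∉ s, inner ℝ (T.coordGrad i) u = 0 := by
  constructor
  · intro hu i hi
    rw [vectorSpan] at hu
    induction hu using Submodule.span_induction with
    | mem x hx =>
      obtain ⟨_, ⟨j, hj, rfl⟩, _, ⟨k, hk, rfl⟩, rfl⟩ := hx
      simp only [vsub_eq_sub]
      have hne : ∀ l ∈ s, i ≠ l := fun l hl h => hi (h ▸ hl)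
      rw [inner_coordGrad_sub, T.coord_point_of_ne (hne j hj), T.coord_point_of_ne (hne k hk),
        sub_zero]
    | zero => simp
    | add x y _ _ hx hy => rw [inner_add_right, hx, hy, add_zero]
    | smul a x _ hx => rw [inner_smul_right, hx, mul_zero]
  · intro h
    obtain ⟨k, hk⟩ := hs
    rw [← T.sum_inner_coordGrad_smul (T.points k) u]
    refine Submodule.sum_mem _ fun i _ => ?_
    by_cases hi : i ∈ s
    · exact Submodule.smul_mem _ _ (vsub_mem_vectorSpan ℝ ⟨i, hi, rfl⟩ ⟨k, hk, rfl⟩)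
    · rw [h i hi, zero_smul]; exact Submodule.zero_mem _

/-! ### Polar vertices and feet of perpendiculars -/

/-- The vertex of the polar body of `T` with respect to `o` that is dual to the face opposite
vertex `i`: the plane of this face is `{y | ⟪polar i, y - o⟫ = 1}`. -/
noncomputable def polar (i : Fin 4) : E3 := -((T.coord i o)⁻¹ • T.coordGrad i)

/-- The foot of the perpendicular from `o` to the plane of the face opposite vertex `i`. -/
noncomputable def foot (i : Fin 4) : E3 := o + (‖T.polar o i‖ ^ 2)⁻¹ • T.polar o i

variable {T o}

lemma coord_eq_polar (ho : o ∈ interior T.body) (i : Fin 4) (y : E3) :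
    T.coord i y = T.coord i o * (1 - inner ℝ (T.polar o i) (y - o)) := by
  have h := (T.coord_pos_of_mem_interior ho i).ne'
  rw [T.coord_eq_add_inner i y o, polar, inner_neg_left, inner_smul_left]
  simp; field_simp

lemma polar_ne_zero (ho : o ∈ interior T.body) (i : Fin 4) : T.polar o i ≠ 0 := by
  intro h
  obtain ⟨j, hj⟩ : ∃ j, i ≠ j := ⟨i + 1, by omega⟩
  have h1 := coord_eq_polar ho i (T.points j)
  rw [h, T.coord_point_of_ne hj] at h1
  have := T.coord_pos_of_mem_interior ho i
  simp at h1; linarith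

lemma coordGrad_eq_polar (ho : o ∈ interior T.body) (i : Fin 4) :
    T.coordGrad i = -(T.coord i o • T.polar o i) := by
  have h := (T.coord_pos_of_mem_interior ho i).ne'
  rw [polar, smul_neg, neg_neg, smul_smul, mul_inv_cancel₀ h, one_smul]

lemma foot_sub (i : Fin 4) : T.foot o i - o = (‖T.polar o i‖ ^ 2)⁻¹ • T.polar o i := by
  simp [foot]

/-- Whether the foot of face `i` lies beyond face `j` is a condition on the polar vertices. -/
lemma coord_foot (ho : o ∈ interior T.body) (i j : Fin 4) :
    T.coord j (T.foot o i) =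
      T.coord j o * (‖T.polar o i‖ ^ 2)⁻¹ *
        (‖T.polar o i‖ ^ 2 - inner ℝ (T.polar o j) (T.polar o i)) := by
  have h : ‖T.polar o i‖ ≠ 0 := norm_ne_zero_iff.2 (polar_ne_zero ho i)
  rw [coord_eq_polar ho, foot_sub, inner_smul_right]; field_simp

lemma coord_foot_self (ho : o ∈ interior T.body) (i : Fin 4) : T.coord i (T.foot o i) = 0 := by
  rw [coord_foot ho, real_inner_self_eq_norm_sq, sub_self, mul_zero]

lemma coord_foot_neg_iff (ho : o ∈ interior T.body) (i j : Fin 4) :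
    T.coord j (T.foot o i) < 0 ↔
      ‖T.polar o i‖ ^ 2 < inner ℝ (T.polar o j) (T.polar o i) := by
  have h : 0 < ‖T.polar o i‖ := norm_pos_iff.2 (polar_ne_zero ho i)
  have h2 := T.coord_pos_of_mem_interior ho j
  have hc : 0 < T.coord j o * (‖T.polar o i‖ ^ 2)⁻¹ := by positivity
  rw [coord_foot ho, ← not_le, mul_nonneg_iff_of_pos_left hc, sub_nonneg, not_le]

lemma coord_foot_pos_iff (ho : o ∈ interior T.body) (i j : Fin 4) :
    0 < T.coord j (T.foot o i) ↔
      inner ℝ (T.polar o j) (T.polar o i) < ‖T.polar o i‖ ^ 2 := by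
  have h : 0 < ‖T.polar o i‖ := norm_pos_iff.2 (polar_ne_zero ho i)
  have h2 := T.coord_pos_of_mem_interior ho j
  rw [coord_foot ho, mul_pos_iff_of_pos_left (by positivity), sub_pos]

/-- The vector from `o` to the foot is normal to the face. -/
lemma inner_foot_sub (ho : o ∈ interior T.body) (i : Fin 4) (x y : E3) :
    inner ℝ (T.foot o i - o) (x - y) =
      (‖T.polar o i‖ ^ 2)⁻¹ * (T.coord i o)⁻¹ * (T.coord i y - T.coord i x) := by
  have h2 := (T.coord_pos_of_mem_interior ho i).ne'
  rw [foot_sub, inner_smul_left, coord_eq_polar ho i x, coord_eq_polar ho i y,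
    show x - y = (x - o) - (y - o) by abel, inner_sub_right]
  simp; field_simp; ring

/-! ### The extended gradient as a projection onto the tangent cone -/

/-- The residual of the unit radial vector after subtraction of `v` is an outer normal vector of
`T` at `p`. For a tangential candidate `v` this characterises the projection of the unit radial
vector onto the tangent cone; `v = 0` is admitted and belongs to equilibrium points. -/
def IsResidualNormal (T : Tetrahedron) (o p v : E3) : Prop :=
  ∀ x ∈ T.body, inner ℝ (‖p - o‖⁻¹ • (p - o) - v) (x - p) ≤ 0

lemma isResidualNormal_smul {p V : E3}
    (h : ∀ x ∈ T.body, inner ℝ ((p - o) - V) (x - p) ≤ 0) :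
    T.IsResidualNormal o p (‖p - o‖⁻¹ • V) := by
  intro x hx
  rw [← smul_sub, inner_smul_left]
  exact mul_nonpos_of_nonneg_of_nonpos (by simp) (h x hx)

lemma IsEquilibrium.isResidualNormal {p : E3} (h : T.IsEquilibrium o p) :
    T.IsResidualNormal o p 0 := by
  have := isResidualNormal_smul (T := T) (o := o) (p := p) (V := 0) fun x hx => by
    rw [sub_zero, real_inner_comm]; exact h.2.2 x hx
  rwa [smul_zero] at this

lemma eq_faceGradient_iff {s : Finset (Fin 4)} (hs : s.Nonempty) {p v : E3} :
    v = T.faceGradient o s p ↔ (∀ i ∉ s, inner ℝ (T.coordGrad i) v = 0) ∧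
      ∀ u, (∀ i ∉ s, inner ℝ (T.coordGrad i) u = 0) →
        inner ℝ (‖p - o‖⁻¹ • (p - o) - v) u = 0 := by
  rw [faceGradient, dist_eq_norm]
  simp only [← T.mem_vectorSpan_iff hs]
  constructor
  · rintro rfl
    exact ⟨Submodule.starProjection_apply_mem _ _,
      fun u hu => Submodule.starProjection_inner_eq_zero _ u hu⟩
  · rintro ⟨h1, h2⟩
    symm
    exact Submodule.eq_starProjection_of_mem_of_inner_eq_zero h1 h2

lemma IsCandidateGradient.exists_face {p v : E3} (h : T.IsCandidateGradient o p v) :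
    ∃ s : Finset (Fin 4), (s.card = 2 ∨ s.card = 3) ∧ p ∈ T.closedFace s ∧
      (∀ i ∉ s, inner ℝ (T.coordGrad i) v = 0) ∧
      (∀ u, (∀ i ∉ s, inner ℝ (T.coordGrad i) u = 0) →
        inner ℝ (‖p - o‖⁻¹ • (p - o) - v) u = 0) ∧
      ∃ ε : ℝ, 0 < ε ∧ p + ε • v ∈ T.closedFace s := by
  obtain ⟨s, hs, hp, hv, hε⟩ := h
  have hne : s.Nonempty := by rw [← Finset.card_pos]; omega
  obtain ⟨h1, h2⟩ := (eq_faceGradient_iff hne).1 hv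
  exact ⟨s, hs, hp, h1, h2, hε⟩

lemma IsCandidateGradient.inner_self {p v : E3} (h : T.IsCandidateGradient o p v) :
    inner ℝ (‖p - o‖⁻¹ • (p - o)) v = ‖v‖ ^ 2 := by
  obtain ⟨s, -, -, h1, h2, -⟩ := h.exists_face
  have := h2 v h1
  rw [inner_sub_left, real_inner_self_eq_norm_sq] at this
  linarith

/-- At a candidate point some barycentric coordinate vanishes: it lies on the boundary. -/
lemma IsCandidateGradient.exists_coord_eq_zero {p v : E3} (h : T.IsCandidateGradient o p v) :
    p ∈ T.body ∧ ∃ i, T.coord i p = 0 := by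
  obtain ⟨s, hs, hp, -⟩ := h.exists_face
  refine ⟨T.closedFace_subset_body s hp, ?_⟩
  have : ∃ i, i ∉ s := by
    by_contra! hall
    have : s = Finset.univ := Finset.eq_univ_iff_forall.2 hall
    rw [this] at hs
    simp at hs
  exact this.imp fun i hi => (T.mem_closedFace_iff.1 hp).2 i hi

lemma IsResidualNormal.inner_candidate_le {p v w : E3} (hv : T.IsResidualNormal o p v)
    (hw : T.IsCandidateGradient o p w) : ‖w‖ ^ 2 ≤ inner ℝ v w := by
  rw [← hw.inner_self, ← sub_nonpos, ← inner_sub_left]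
  obtain ⟨s, -, -, -, -, ε, hε, hm⟩ := hw.exists_face
  have := hv _ (T.closedFace_subset_body s hm)
  rw [add_sub_cancel_left, inner_smul_right] at this
  exact nonpos_of_mul_nonpos_right this hε

/-- A candidate gradient whose residual is an outer normal vector is the extended gradient. -/
lemma IsExtendedGradient.eq_of_isResidualNormal {p v w : E3} (hv : T.IsExtendedGradient o p v)
    (hw : T.IsCandidateGradient o p w) (hn : T.IsResidualNormal o p w) : v = w := by
  have h1 := hn.inner_candidate_le hv.2.1
  have h2 := hv.2.2 w hw
  have h3 := norm_sub_sq_real v w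
  rw [real_inner_comm] at h1
  have : ‖v - w‖ ^ 2 ≤ 0 := by nlinarith [norm_nonneg w]
  exact sub_eq_zero.1 (norm_eq_zero.1 (pow_eq_zero_iff two_ne_zero |>.1
    (le_antisymm this (sq_nonneg _))))

lemma IsEquilibrium.not_isExtendedGradient {p v : E3} (h : T.IsEquilibrium o p) :
    ¬ T.IsExtendedGradient o p v := by
  intro hv
  have := h.isResidualNormal.inner_candidate_le hv.2.1
  rw [inner_zero_left] at this
  exact hv.1 (norm_eq_zero.1 (pow_eq_zero_iff two_ne_zero |>.1 (le_antisymm this (sq_nonneg _))))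

/-- The projection of a vector `g` onto the tangent cone of `T` at `p`. -/
lemma exists_tangentCone_projection (T : Tetrahedron) (p g : E3) :
    ∃ v : E3, (∀ i, T.coord i p = 0 → 0 ≤ inner ℝ (T.coordGrad i) v) ∧
      inner ℝ (g - v) v = 0 ∧
      ∀ x ∈ T.body, inner ℝ (g - v) (x - p) ≤ 0 := by
  set K : Set E3 := {u | ∀ i, T.coord i p = 0 → 0 ≤ inner ℝ (T.coordGrad i) u} with hK
  have hKc : IsClosed K := by
    simp only [hK, Set.ofPred_forall]
    exact isClosed_iInter fun i => isClosed_iInter fun _ =>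
      isClosed_le continuous_const (by fun_prop)
  have hadd : ∀ u ∈ K, ∀ w ∈ K, u + w ∈ K := fun u hu w hw i hi => by
    rw [inner_add_right]; exact add_nonneg (hu i hi) (hw i hi)
  have hsmul : ∀ u ∈ K, ∀ a : ℝ, 0 ≤ a → a • u ∈ K := fun u hu a ha i hi => by
    rw [inner_smul_right]; exact mul_nonneg ha (hu i hi)
  have h0 : (0 : E3) ∈ K := fun i _ => by simp
  have hconv : Convex ℝ K := fun u hu w hw a b ha hb _ =>
    hadd _ (hsmul u hu a ha) _ (hsmul w hw b hb)
  obtain ⟨v, hvK, hv⟩ := exists_norm_eq_iInf_of_complete_convex ⟨0, h0⟩ hKc.isComplete hconv g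
  rw [norm_eq_iInf_iff_real_inner_le_zero hconv hvK] at hv
  refine ⟨v, hvK, le_antisymm ?_ ?_, fun x hx => ?_⟩
  · simpa using hv (v + v) (hadd v hvK v hvK)
  · simpa using hv 0 h0
  · have := hv (v + (x - p)) (hadd v hvK _ fun i hi => by
      rw [inner_coordGrad_sub, hi, sub_zero]; exact T.mem_body_iff.1 hx i)
    simpa using this

/-- A tangential direction can be followed inside `T` for some time; then exactly those
coordinates are positive that are so at the start or grow. -/
lemma exists_step {p v : E3} (hp : p ∈ T.body)
    (hv : ∀ i, T.coord i p = 0 → 0 ≤ inner ℝ (T.coordGrad i) v) :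
    ∃ ε : ℝ, 0 < ε ∧ ∀ i, 0 ≤ T.coord i (p + ε • v) ∧
      (0 < T.coord i (p + ε • v) ↔ 0 < T.coord i p ∨ 0 < inner ℝ (T.coordGrad i) v) := by
  have key : ∀ᶠ ε in nhdsWithin (0 : ℝ) (Set.Ioi 0), ∀ i, 0 ≤ T.coord i (p + ε • v) ∧
      (0 < T.coord i (p + ε • v) ↔ 0 < T.coord i p ∨ 0 < inner ℝ (T.coordGrad i) v) := by
    rw [Filter.eventually_all]
    intro i
    rcases (T.mem_body_iff.1 hp i).eq_or_lt with h | h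
    · filter_upwards [self_mem_nhdsWithin] with ε hε
      have hε' : 0 < ε := hε
      have := hv i h.symm
      rw [coord_add, inner_smul_right, ← h, zero_add]
      refine ⟨by positivity, ?_⟩
      rw [mul_pos_iff_of_pos_left hε']
      simp
    · have hc : Continuous fun ε : ℝ => T.coord i (p + ε • v) :=
        (T.continuous_coord i).comp (by fun_prop)
      have : ∀ᶠ ε in nhds (0 : ℝ), 0 < T.coord i (p + ε • v) :=
        hc.continuousAt.eventually (lt_mem_nhds (by simpa using h))
      filter_upwards [nhdsWithin_le_nhds this] with ε hε
      exact ⟨hε.le, by simp [hε, h]⟩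
  obtain ⟨ε, h1, h2⟩ := (key.and self_mem_nhdsWithin).exists
  exact ⟨ε, h2, h1⟩

/-- The residual of the projection onto the tangent cone is normal to the smallest face that
contains the direction of projection. -/
lemma inner_residual_eq_zero {p v ν : E3} (hp : p ∈ T.body)
    (hv : ∀ i, T.coord i p = 0 → 0 ≤ inner ℝ (T.coordGrad i) v) (hν : inner ℝ ν v = 0)
    (hn : ∀ x ∈ T.body, inner ℝ ν (x - p) ≤ 0) {i : Fin 4}
    (hi : 0 < T.coord i p ∨ 0 < inner ℝ (T.coordGrad i) v) :
    inner ℝ ν (T.points i - p) = 0 := by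
  obtain ⟨ε, -, h⟩ := exists_step hp hv
  have hsum := T.inner_sub_eq_sum ν (p + ε • v) p
  rw [add_sub_cancel_left, inner_smul_right, hν, mul_zero] at hsum
  have hle : ∀ j ∈ Finset.univ,
      T.coord j (p + ε • v) * inner ℝ ν (T.points j - p) ≤ 0 := fun j _ =>
    mul_nonpos_of_nonneg_of_nonpos (h j).1 (hn _ (T.point_mem_body j))
  have := (Finset.sum_eq_zero_iff_of_nonpos hle).1 hsum.symm i (Finset.mem_univ i)
  exact (mul_eq_zero.1 this).resolve_left (((h i).2.2 hi).ne')

lemma eq_zero_of_inner_points {ν p : E3} (h : ∀ i, inner ℝ ν (T.points i - p) = 0) : ν = 0 := by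
  rw [← T.sum_inner_smul_coordGrad ν p]; simp [h]

lemma inner_coordGrad_radial_neg (ho : o ∈ interior T.body) {p : E3} {i : Fin 4}
    (hi : T.coord i p = 0) : inner ℝ (T.coordGrad i) (p - o) < 0 := by
  rw [inner_coordGrad_sub, hi]
  linarith [T.coord_pos_of_mem_interior ho i]

lemma ne_of_coord_eq_zero (ho : o ∈ interior T.body) {p : E3} {i : Fin 4}
    (hi : T.coord i p = 0) : p ≠ o := by
  rintro rfl
  exact (T.coord_pos_of_mem_interior ho i).ne' hi

lemma IsExtendedGradient.ne (ho : o ∈ interior T.body) {p v : E3}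
    (h : T.IsExtendedGradient o p v) : p ≠ o := by
  obtain ⟨-, i, hi⟩ := h.2.1.exists_coord_eq_zero
  exact ne_of_coord_eq_zero ho hi

/-- The extended gradient is the projection of the unit radial vector onto the tangent cone. -/
lemma IsExtendedGradient.isResidualNormal (ho : o ∈ interior T.body) {p v : E3}
    (hv : T.IsExtendedGradient o p v) : T.IsResidualNormal o p v := by
  obtain ⟨hp, i₀, hi₀⟩ := hv.2.1.exists_coord_eq_zero
  have hpo : 0 < ‖p - o‖ := norm_pos_iff.2 (sub_ne_zero.2 (ne_of_coord_eq_zero ho hi₀))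
  obtain ⟨w, hw, hperp, hn⟩ := T.exists_tangentCone_projection p (‖p - o‖⁻¹ • (p - o))
  have hw0 : w ≠ 0 := by
    rintro rfl
    have := IsResidualNormal.inner_candidate_le (T := T) (o := o) (p := p) (v := 0) hn hv.2.1
    rw [inner_zero_left] at this
    exact hv.1 (norm_eq_zero.1 (pow_eq_zero_iff two_ne_zero |>.1
      (le_antisymm this (sq_nonneg _))))
  set s : Finset (Fin 4) :=
    Finset.univ.filter fun i => 0 < T.coord i p ∨ 0 < inner ℝ (T.coordGrad i) w with hs
  have hmem : ∀ i, i ∈ s ↔ 0 < T.coord i p ∨ 0 < inner ℝ (T.coordGrad i) w := fun i => by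
    simp [hs]
  have hnot : ∀ i ∉ s, T.coord i p = 0 ∧ inner ℝ (T.coordGrad i) w = 0 := by
    intro i hi
    rw [hmem, not_or, not_lt, not_lt] at hi
    have h0 := le_antisymm hi.1 (T.mem_body_iff.1 hp i)
    exact ⟨h0, le_antisymm hi.2 (hw i h0)⟩
  have hres : ∀ i ∈ s, inner ℝ (‖p - o‖⁻¹ • (p - o) - w) (T.points i - p) = 0 :=
    fun i hi => inner_residual_eq_zero hp hw hperp hn ((hmem i).1 hi)
  have hne4 : s.card ≠ 4 := by
    intro h4
    have hall : ∀ i, i ∈ s := fun i => by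
      rw [(Finset.card_eq_iff_eq_univ s).1 (by simpa using h4)]; simp
    have hν := eq_zero_of_inner_points fun i => hres i (hall i)
    have h1 := (hmem i₀).1 (hall i₀)
    rw [hi₀, ← sub_eq_zero.1 hν, inner_smul_right] at h1
    have h2 := inner_coordGrad_radial_neg ho hi₀
    have h3 : 0 < ‖p - o‖⁻¹ := by positivity
    rcases h1 with h1 | h1
    · exact lt_irrefl _ h1
    · nlinarith
  have hle : s.card ≤ 4 := by simpa using Finset.card_le_univ s
  have hne01 : ¬ s.card ≤ 1 := by
    intro h1
    apply hw0
    have hz : ∀ i, inner ℝ (T.coordGrad i) w = 0 := by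
      intro i
      by_cases hi : i ∈ s
      · have hsum := T.sum_inner_coordGrad w
        rwa [Finset.sum_eq_single i (fun j _ hji => (hnot j fun hj =>
          hji (Finset.card_le_one.1 h1 j hj i hi)).2) (by simp)] at hsum
      · exact (hnot i hi).2
    rw [← T.sum_inner_coordGrad_smul p w]
    simp [hz]
  have hne : s.Nonempty := by rw [← Finset.card_pos]; omega
  have hcand : T.IsCandidateGradient o p w := by
    refine ⟨s, by omega, T.mem_closedFace_iff.2 ⟨T.mem_body_iff.1 hp, fun i hi => (hnot i hi).1⟩,
      (eq_faceGradient_iff hne).2 ⟨fun i hi => (hnot i hi).2, fun u hu => ?_⟩, ?_⟩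
    · rw [← T.sum_inner_coordGrad_smul p u, inner_sum]
      refine Finset.sum_eq_zero fun i _ => ?_
      rw [inner_smul_right]
      by_cases hi : i ∈ s
      · rw [hres i hi, mul_zero]
      · rw [hu i hi, zero_mul]
    · obtain ⟨ε, hε, h⟩ := exists_step hp hw
      exact ⟨ε, hε, T.mem_closedFace_iff.2 ⟨fun i => (h i).1, fun i hi => by
        rw [coord_add, inner_smul_right, (hnot i hi).1, (hnot i hi).2]; ring⟩⟩
  rw [hv.eq_of_isResidualNormal hcand hn]
  exact hn

/-! ### The flow in faces and edges -/

/-- Where the radial field of a face plane points into the face, it is the extended gradient. -/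
lemma IsExtendedGradient.eq_of_face (ho : o ∈ interior T.body) {p v : E3}
    (hv : T.IsExtendedGradient o p v) {i : Fin 4} (hi : T.coord i p = 0)
    (hin : ∀ j ≠ i, T.coord j p = 0 → T.coord j (T.foot o i) ≤ 0) :
    v = ‖p - o‖⁻¹ • (p - T.foot o i) := by
  obtain ⟨hp, -⟩ := hv.2.1.exists_coord_eq_zero
  have hpo : 0 < ‖p - o‖ := norm_pos_iff.2 (sub_ne_zero.2 (ne_of_coord_eq_zero ho hi))
  have hpar : ∀ x y, T.coord i x = T.coord i y → inner ℝ (T.foot o i - o) (x - y) = 0 :=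
    fun x y h => by rw [inner_foot_sub ho, h, sub_self, mul_zero]
  refine hv.eq_of_isResidualNormal ?_ (isResidualNormal_smul fun x hx => ?_)
  · refine ⟨Finset.univ.erase i, by simp, T.mem_closedFace_iff.2 ⟨T.mem_body_iff.1 hp, fun j hj => ?_⟩,
      (eq_faceGradient_iff ⟨i + 1, by simp⟩).2 ⟨fun j hj => ?_, fun u hu => ?_⟩, ?_⟩
    · obtain rfl : j = i := by simpa using hj
      exact hi
    · obtain rfl : j = i := by simpa using hj
      rw [inner_smul_right, inner_coordGrad_sub, hi, coord_foot_self ho]; simp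
    · rw [← smul_sub, inner_smul_left, show p - o - (p - T.foot o i) = T.foot o i - o by abel]
      have := hpar (o + u) o (by rw [coord_add, hu i (by simp), add_zero])
      rw [add_sub_cancel_left] at this
      rw [this, mul_zero]
    · obtain ⟨ε, hε, h⟩ := exists_step (v := ‖p - o‖⁻¹ • (p - T.foot o i)) hp fun j hj => by
        rw [inner_smul_right, inner_coordGrad_sub, hj]
        by_cases hji : j = i
        · subst hji; rw [coord_foot_self ho]; simp
        · have := hin j hji hj
          exact mul_nonneg (by positivity) (by linarith)
      refine ⟨ε, hε, T.mem_closedFace_iff.2 ⟨fun j => (h j).1, fun j hj => ?_⟩⟩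
      obtain rfl : j = i := by simpa using hj
      rw [coord_add, inner_smul_right, inner_smul_right, inner_coordGrad_sub, hi,
        coord_foot_self ho]
      simp
  · rw [show p - o - (p - T.foot o i) = T.foot o i - o by abel, inner_foot_sub ho, hi]
    have h1 := T.mem_body_iff.1 hx i
    have h2 := T.coord_pos_of_mem_interior ho i
    have : (‖T.polar o i‖ ^ 2)⁻¹ * (T.coord i o)⁻¹ * T.coord i x ≥ 0 := by positivity
    linarith

/-- On an edge that carries an equilibrium point, the extended gradient points away from it. -/
lemma IsExtendedGradient.eq_of_saddle_edge {p v h : E3}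
    (hv : T.IsExtendedGradient o p v) (hh : T.IsEquilibrium o h) {a b : Fin 4} (hab : a ≠ b)
    (hpa : 0 < T.coord a p) (hpb : 0 < T.coord b p)
    (hp0 : ∀ i, i ≠ a → i ≠ b → T.coord i p = 0) (hh0 : ∀ i, i ≠ a → i ≠ b → T.coord i h = 0)
    (ha : inner ℝ (T.points a - h) (h - o) = 0) (hb : inner ℝ (T.points b - h) (h - o) = 0) :
    v = ‖p - o‖⁻¹ • (p - h) := by
  obtain ⟨hp, -⟩ := hv.2.1.exists_coord_eq_zero
  have hedge : ∀ u, (∀ i, i ≠ a → i ≠ b → inner ℝ (T.coordGrad i) u = 0) →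
      inner ℝ (h - o) u = 0 := by
    intro u hu
    rw [← T.sum_inner_coordGrad_smul h u, inner_sum]
    refine Finset.sum_eq_zero fun i _ => ?_
    rw [inner_smul_right]
    by_cases hia : i = a
    · rw [hia, real_inner_comm (T.points a - h) (h - o), ha, mul_zero]
    by_cases hib : i = b
    · rw [hib, real_inner_comm (T.points b - h) (h - o), hb, mul_zero]
    rw [hu i hia hib, zero_mul]
  have hph : ∀ i, i ≠ a → i ≠ b → inner ℝ (T.coordGrad i) (p - h) = 0 := fun i h1 h2 => by
    rw [inner_coordGrad_sub, hp0 i h1 h2, hh0 i h1 h2, sub_zero]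
  refine hv.eq_of_isResidualNormal ?_ (isResidualNormal_smul fun x hx => ?_)
  · refine ⟨{a, b}, Or.inl (Finset.card_pair hab), T.mem_closedFace_iff.2
      ⟨T.mem_body_iff.1 hp, fun j hj => ?_⟩,
      (eq_faceGradient_iff ⟨a, by simp⟩).2 ⟨fun j hj => ?_, fun u hu => ?_⟩, ?_⟩
    · simp only [Finset.mem_insert, Finset.mem_singleton, not_or] at hj
      exact hp0 j hj.1 hj.2
    · simp only [Finset.mem_insert, Finset.mem_singleton, not_or] at hj
      rw [inner_smul_right, hph j hj.1 hj.2, mul_zero]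
    · rw [← smul_sub, inner_smul_left, show p - o - (p - h) = h - o by abel,
        hedge u fun i h1 h2 => hu i (by simp [h1, h2]), mul_zero]
    · obtain ⟨ε, hε, hst⟩ := exists_step (v := ‖p - o‖⁻¹ • (p - h)) hp fun j hj => by
        rw [inner_smul_right, hph j (fun e => by subst e; exact hpa.ne' hj)
          (fun e => by subst e; exact hpb.ne' hj), mul_zero]
      refine ⟨ε, hε, T.mem_closedFace_iff.2 ⟨fun j => (hst j).1, fun j hj => ?_⟩⟩
      simp only [Finset.mem_insert, Finset.mem_singleton, not_or] at hj
      rw [coord_add, inner_smul_right, inner_smul_right, hph j hj.1 hj.2, hp0 j hj.1 hj.2]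
      simp
  · rw [show p - o - (p - h) = h - o by abel, show x - p = (x - h) - (p - h) by abel,
      inner_sub_right, hedge _ hph, sub_zero, real_inner_comm]
    exact hh.2.2 x hx

/-- Along an edge direction of every face that contains `p`, the extended gradient has the same
component as the unit radial vector. -/
lemma IsExtendedGradient.inner_edge {p v : E3} (hv : T.IsExtendedGradient o p v) {a b : Fin 4}
    (ha : 0 < T.coord a p) (hb : 0 < T.coord b p) :
    inner ℝ v (T.points a - T.points b) =
      ‖p - o‖⁻¹ * inner ℝ (p - o) (T.points a - T.points b) := by
  obtain ⟨s, -, hp, -, h2, -⟩ := hv.2.1.exists_face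
  have hmem : ∀ i, 0 < T.coord i p → i ∈ s := fun i hi => by
    by_contra hc
    exact hi.ne' ((T.mem_closedFace_iff.1 hp).2 i hc)
  have := h2 (T.points a - T.points b) fun i hi => by
    rw [inner_coordGrad_sub, T.coord_point_of_ne, T.coord_point_of_ne, sub_zero]
    · rintro rfl; exact hi (hmem _ hb)
    · rintro rfl; exact hi (hmem _ ha)
  rw [inner_sub_left, inner_smul_left] at this
  simpa using (sub_eq_zero.1 this).symm

/-- In the interior of a face the extended gradient is tangential to the face. -/
lemma IsExtendedGradient.inner_coordGrad {p v : E3} (hv : T.IsExtendedGradient o p v) {j : Fin 4}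
    (hj : ∀ i ≠ j, 0 < T.coord i p) : inner ℝ (T.coordGrad j) v = 0 := by
  obtain ⟨s, hs, hp, h1, -⟩ := hv.2.1.exists_face
  refine h1 j fun hjs => ?_
  have : s = Finset.univ := Finset.eq_univ_iff_forall.2 fun i => by
    by_cases hij : i = j
    · exact hij ▸ hjs
    · by_contra hc
      exact (hj i hij).ne' ((T.mem_closedFace_iff.1 hp).2 i hc)
  rw [this] at hs
  simp at hs

/-! ### Trapping sets of the ascending flow -/

/-- `γ` follows the extended gradient on the time interval `[a, b]`. -/
def IsAscendingOn (T : Tetrahedron) (o : E3) (γ : ℝ → E3) (a b : ℝ) : Prop :=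
  ContinuousOn γ (Set.Icc a b) ∧ ∀ t ∈ Set.Ico a b, ∃ v, T.IsExtendedGradient o (γ t) v ∧
    HasDerivWithinAt γ v (Set.Ici t) t

/-- A compact part `M` of the boundary of `T` such that, at every point `z` of `M`, the projection
of the unit radial vector onto the tangent cone of `T` points into `M`, in the sense that it has
no positive component towards any point `y` to which `z` is closest within `M`. -/
def IsTrap (T : Tetrahedron) (o : E3) (M : Set E3) : Prop :=
  IsCompact M ∧ (∀ z ∈ M, z ∈ T.body ∧ ∃ i, T.coord i z = 0) ∧
    ∀ z ∈ M, ∃ v, T.IsResidualNormal o z v ∧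
      ∀ y, (∀ z' ∈ M, ‖y - z‖ ≤ ‖y - z'‖) → inner ℝ (y - z) v ≤ 0

/-- The unit radial field is one-sided Lipschitz away from its centre. -/
lemma inner_sub_unit_sub_unit_le {x y : E3} {W : ℝ} (hx : x ≠ 0) (hy : y ≠ 0)
    (hxW : ‖x‖⁻¹ ≤ W) (hyW : ‖y‖⁻¹ ≤ W) :
    inner ℝ (x - y) (‖x‖⁻¹ • x - ‖y‖⁻¹ • y) ≤ W * ‖x - y‖ ^ 2 := by
  have hx' : 0 < ‖x‖ := norm_pos_iff.2 hx
  have hy' : 0 < ‖y‖ := norm_pos_iff.2 hy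
  have hcs := real_inner_le_norm x y
  have h1 : inner ℝ (x - y) (‖x‖⁻¹ • x - ‖y‖⁻¹ • y) =
      (‖x‖⁻¹ + ‖y‖⁻¹) * (‖x‖ * ‖y‖ - inner ℝ x y) := by
    simp only [inner_sub_left, inner_sub_right, inner_smul_right, real_inner_self_eq_norm_sq,
      real_inner_comm x y]
    field_simp; ring
  rw [h1, norm_sub_sq_real]
  nlinarith [sq_nonneg (‖x‖ - ‖y‖), mul_nonneg (sub_nonneg.2 hxW) (sub_nonneg.2 hcs),
    mul_nonneg (sub_nonneg.2 hyW) (sub_nonneg.2 hcs),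
    mul_nonneg ((inv_pos.2 hx').le.trans hxW) (sq_nonneg (‖x‖ - ‖y‖))]

/-- The distance of boundary points from `o` is bounded away from zero. -/
lemma inv_norm_sub_le (ho : o ∈ interior T.body) {p : E3} {i : Fin 4} (hi : T.coord i p = 0) :
    ‖p - o‖⁻¹ ≤ ∑ j, ‖T.polar o j‖ := by
  have hpo : 0 < ‖p - o‖ := norm_pos_iff.2 (sub_ne_zero.2 (ne_of_coord_eq_zero ho hi))
  have h1 := coord_eq_polar ho i p
  rw [hi, eq_comm, mul_eq_zero, or_iff_right (T.coord_pos_of_mem_interior ho i).ne',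
    sub_eq_zero] at h1
  have h2 := real_inner_le_norm (T.polar o i) (p - o)
  have h3 : ‖T.polar o i‖ ≤ ∑ j, ‖T.polar o j‖ :=
    Finset.single_le_sum (f := fun j => ‖T.polar o j‖) (fun _ _ => norm_nonneg _)
      (Finset.mem_univ i)
  rw [inv_le_iff_one_le_mul₀ hpo]
  nlinarith

/-- A trajectory that meets a trap stays in it: the squared distance from the trap satisfies
a Grönwall inequality, since outer normals of a convex body are monotone. -/
theorem IsTrap.mem (ho : o ∈ interior T.body) {M : Set E3} (hM : T.IsTrap o M) {γ : ℝ → E3}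
    {a b : ℝ} (hγ : T.IsAscendingOn o γ a b) (ha : γ a ∈ M) {t : ℝ} (ht : t ∈ Set.Icc a b) :
    γ t ∈ M := by
  obtain ⟨hcomp, hbd, hM⟩ := hM
  obtain ⟨hcont, hder⟩ := hγ
  set W := ∑ j, ‖T.polar o j‖ with hW
  set f : ℝ → ℝ := fun t => Metric.infDist (γ t) M ^ 2 with hf
  have hne : M.Nonempty := ⟨_, ha⟩
  have hfc : ContinuousOn f (Set.Icc a b) :=
    ((Metric.continuous_infDist_pt M).comp_continuousOn hcont).pow 2
  have key : ∀ t ∈ Set.Ico a b, ∀ r, 2 * W * f t < r →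
      ∃ᶠ s in nhdsWithin t (Set.Ioi t), (s - t)⁻¹ * (f s - f t) < r := by
    intro t ht r hr
    obtain ⟨v, hv, hd⟩ := hder t ht
    obtain ⟨z, hz, hzd⟩ := hcomp.exists_infDist_eq_dist hne (γ t)
    obtain ⟨w, hw, hwn⟩ := hM z hz
    obtain ⟨hzb, i, hi⟩ := hbd z hz
    obtain ⟨hpb, j, hj⟩ := hv.2.1.exists_coord_eq_zero
    have hnear : ∀ z' ∈ M, ‖γ t - z‖ ≤ ‖γ t - z'‖ := fun z' hz' => by
      rw [← dist_eq_norm, ← dist_eq_norm, ← hzd]; exact Metric.infDist_le_dist_of_mem hz'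
    have hft : f t = ‖γ t - z‖ ^ 2 := by rw [hf]; simp only; rw [hzd, dist_eq_norm]
    have h1 := hv.isResidualNormal ho z hzb
    have h2 := hw (γ t) hpb
    have h3 := hwn (γ t) hnear
    have h4 := inner_sub_unit_sub_unit_le (W := W) (sub_ne_zero.2 (ne_of_coord_eq_zero ho hj))
      (sub_ne_zero.2 (ne_of_coord_eq_zero ho hi)) (inv_norm_sub_le ho hj) (inv_norm_sub_le ho hi)
    rw [sub_sub_sub_cancel_right] at h4
    have h5 : inner ℝ (γ t - z) v ≤ W * f t := by
      rw [hft]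
      refine le_trans ?_ h4
      rw [← neg_sub (γ t) z, inner_neg_right, real_inner_comm] at h1
      rw [real_inner_comm] at h2
      simp only [inner_sub_right] at h1 h2 ⊢
      linarith
    have hφ : HasDerivWithinAt (fun s => ‖γ s - z‖ ^ 2) (2 * inner ℝ (γ t - z) v) (Set.Ioi t) t :=
      ((hd.mono Set.Ioi_subset_Ici_self).sub_const z).norm_sq
    have hev := hφ.limsup_slope_le' (by simp) (r := r) (by linarith)
    refine Filter.Eventually.frequently ?_
    filter_upwards [hev, self_mem_nhdsWithin] with s hs hst
    have hst' : 0 < s - t := sub_pos.2 hst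
    refine lt_of_le_of_lt ?_ hs
    rw [slope_def_field, div_eq_inv_mul, hft]
    have : f s ≤ ‖γ s - z‖ ^ 2 := by
      rw [← dist_eq_norm]
      exact pow_le_pow_left₀ Metric.infDist_nonneg (Metric.infDist_le_dist_of_mem hz) 2
    gcongr
  have hle := le_gronwallBound_of_liminf_deriv_right_le (f' := fun t => 2 * W * f t) (δ := 0)
    (K := 2 * W) (ε := 0) hfc key (by simp [hf, Metric.infDist_zero_of_mem ha]) (by simp) t ht
  rw [gronwallBound_ε0, zero_mul] at hle
  have h0 : Metric.infDist (γ t) M = 0 :=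
    pow_eq_zero_iff two_ne_zero |>.1 (le_antisymm hle (sq_nonneg _))
  exact (hcomp.isClosed.mem_iff_infDist_zero hne).2 h0

lemma IsEquilibrium.isTrap {x : E3} (hx : T.IsEquilibrium o x) {i : Fin 4}
    (hi : T.coord i x = 0) : T.IsTrap o {x} := by
  refine ⟨isCompact_singleton, ?_, ?_⟩
  · rintro z rfl; exact ⟨hx.1, i, hi⟩
  · rintro z rfl; exact ⟨0, hx.isResidualNormal, by simp⟩

/-- A segment along which the flow points towards its end, attached to a trap that contains
this end. -/
lemma IsTrap.union_segment {M : Set E3} (hM : T.IsTrap o M) {x y : E3} (hy : y ∈ M)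
    (hseg : ∀ c : ℝ, 0 ≤ c → c < 1 → x + c • (y - x) ∈ T.body ∧
      (∃ i, T.coord i (x + c • (y - x)) = 0) ∧
      ∃ a : ℝ, 0 ≤ a ∧ T.IsResidualNormal o (x + c • (y - x)) (a • (y - x))) :
    T.IsTrap o (segment ℝ x y ∪ M) := by
  have hcomp : IsCompact (segment ℝ x y) := by
    rw [segment_eq_image']
    exact isCompact_Icc.image (by fun_prop)
  have hcases : ∀ z ∈ segment ℝ x y ∪ M, z ∈ M ∨ ∃ c : ℝ, 0 ≤ c ∧ c < 1 ∧ z = x + c • (y - x) := by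
    rintro z (hz | hz)
    · rw [segment_eq_image'] at hz
      obtain ⟨c, ⟨h0, h1⟩, rfl⟩ := hz
      rcases h1.eq_or_lt with rfl | h1
      · left; simpa using hy
      · exact Or.inr ⟨c, h0, h1, rfl⟩
    · exact Or.inl hz
  refine ⟨hcomp.union hM.1, fun z hz => ?_, fun z hz => ?_⟩
  · rcases hcases z hz with h | ⟨c, h0, h1, rfl⟩
    · exact hM.2.1 z h
    · exact ⟨(hseg c h0 h1).1, (hseg c h0 h1).2.1⟩
  · rcases hcases z hz with h | ⟨c, h0, h1, rfl⟩
    · obtain ⟨v, hv, hv'⟩ := hM.2.2 z h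
      exact ⟨v, hv, fun y' hy' => hv' y' fun z' hz' => hy' z' (Or.inr hz')⟩
    · obtain ⟨-, -, a, ha, hres⟩ := hseg c h0 h1
      refine ⟨_, hres, fun q hq => ?_⟩
      rw [inner_smul_right]
      refine mul_nonpos_of_nonneg_of_nonpos ha ?_
      -- moving from `z` towards `y` inside the segment does not come closer to `q`
      set z := x + c • (y - x) with hz'
      by_contra! hpos
      set D := y - x with hD
      have hclose : ∀ ε : ℝ, 0 < ε → c + ε ≤ 1 → 2 * inner ℝ (q - z) D ≤ ε * ‖D‖ ^ 2 := by
        intro ε hε hcε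
        have := hq (x + (c + ε) • D) (Or.inl (by
          rw [segment_eq_image']; exact ⟨c + ε, ⟨by linarith, hcε⟩, rfl⟩))
        have h2 : q - (x + (c + ε) • D) = (q - z) - ε • D := by rw [hz']; module
        rw [h2] at this
        have h3 := pow_le_pow_left₀ (norm_nonneg _) this 2
        rw [norm_sub_sq_real (q - z), inner_smul_right, norm_smul, Real.norm_of_nonneg hε.le] at h3
        have h4 : ε * (2 * inner ℝ (q - z) D) ≤ ε * (ε * ‖D‖ ^ 2) := by nlinarith
        exact le_of_mul_le_mul_left h4 hε
      have hD0 : 0 < ‖D‖ ^ 2 := by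
        have : D ≠ 0 := by rintro h; rw [h, inner_zero_right] at hpos; exact lt_irrefl _ hpos
        have := norm_pos_iff.2 this
        positivity
      have hmin : 0 < min (1 - c) (inner ℝ (q - z) D / ‖D‖ ^ 2) :=
        lt_min (by linarith) (by positivity)
      have h1' := hclose _ hmin (by linarith [min_le_left (1 - c) (inner ℝ (q - z) D / ‖D‖ ^ 2)])
      have h2' : min (1 - c) (inner ℝ (q - z) D / ‖D‖ ^ 2) * ‖D‖ ^ 2 ≤ inner ℝ (q - z) D := by
        rw [← le_div_iff₀ hD0]; exact min_le_right _ _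
      linarith

/-- The trace of a trajectory that ends at an equilibrium point is a trap. -/
lemma IsAscendingOn.isTrap (ho : o ∈ interior T.body) {γ : ℝ → E3} {a b : ℝ}
    (hγ : T.IsAscendingOn o γ a b) (heq : T.IsEquilibrium o (γ b)) {i : Fin 4}
    (hi : T.coord i (γ b) = 0) : T.IsTrap o (γ '' Set.Icc a b) := by
  refine ⟨isCompact_Icc.image_of_continuousOn hγ.1, ?_, ?_⟩
  · rintro _ ⟨t, ht, rfl⟩
    rcases ht.2.eq_or_lt with rfl | h
    · exact ⟨heq.1, i, hi⟩
    · obtain ⟨v, hv, -⟩ := hγ.2 t ⟨ht.1, h⟩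
      exact hv.2.1.exists_coord_eq_zero
  · rintro _ ⟨t, ht, rfl⟩
    rcases ht.2.eq_or_lt with rfl | h
    · exact ⟨0, heq.isResidualNormal, by simp⟩
    · obtain ⟨v, hv, hd⟩ := hγ.2 t ⟨ht.1, h⟩
      refine ⟨v, hv.isResidualNormal ho, fun y hy => ?_⟩
      have hφ : HasDerivWithinAt (fun s => ‖γ s - y‖ ^ 2) (2 * inner ℝ (γ t - y) v) (Set.Ioi t) t :=
        ((hd.mono Set.Ioi_subset_Ici_self).sub_const y).norm_sq
      by_contra! hpos
      have hneg : 2 * inner ℝ (γ t - y) v < 0 := by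
        rw [← neg_sub, inner_neg_left]; linarith
      have hev := hφ.limsup_slope_le' (by simp) hneg
      obtain ⟨s, hs, hs1, hs2⟩ := (hev.and (Ioo_mem_nhdsGT h)).exists
      rw [slope_def_field, div_neg_iff] at hs
      have := pow_le_pow_left₀ (norm_nonneg _) (hy (γ s) ⟨s, ⟨ht.1.trans hs1.le, hs2.le⟩, rfl⟩) 2
      rw [norm_sub_rev, norm_sub_rev y] at this
      rcases hs with hs | hs <;> linarith [hs.1, hs.2]

end Tetrahedron

/-! ### The combinatorial core -/

/-- `w j` lies beyond the plane through `w i` perpendicular to `w i`. For the vertices of a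
tetrahedron seen from `o` this means that the distance from `o` grows along the edge from vertex
`i` to vertex `j`; for the polar vertices it means that the foot of face `i` lies beyond
face `j`. -/
def Leads (w : Fin 4 → E3) (i j : Fin 4) : Prop := ‖w i‖ ^ 2 < inner ℝ (w j) (w i)

lemma Leads.norm_lt {w : Fin 4 → E3} {i j : Fin 4} (h : Leads w i j) : ‖w i‖ < ‖w j‖ := by
  have h1 := real_inner_le_norm (w j) (w i)
  have h2 : ‖w i‖ ^ 2 < ‖w j‖ * ‖w i‖ := lt_of_lt_of_le h h1
  by_contra! hle
  nlinarith [norm_nonneg (w i)]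

lemma Leads.ne {w : Fin 4 → E3} {i j : Fin 4} (h : Leads w i j) : j ≠ i := by
  rintro rfl; exact lt_irrefl _ h.norm_lt

lemma wellFounded_leads (w : Fin 4 → E3) : WellFounded fun j i => Leads w i j := by
  have : WellFounded fun j i : Fin 4 => ‖w i‖ < ‖w j‖ :=
    @Finite.wellFounded_of_trans_of_irrefl _ _ (fun j i : Fin 4 => ‖w i‖ < ‖w j‖)
      ⟨fun _ _ _ h1 h2 => h2.trans h1⟩ ⟨fun _ => lt_irrefl _⟩
  exact this.mono fun _ _ h => h.norm_lt

/-- The case of `exists_leads_of_chains` in which one of the two chains is trivial: the other one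
has to pass through both vertices that do not belong to the edge. -/
lemma exists_leads_of_chain_to_end {w : Fin 4 → E3} {i j : Fin 4} (hij : i ≠ j) {k : E3}
    {a b : ℝ} (ha : 0 < a) (hb : 0 < b) (hi : w i = k + a • (w i - w j))
    (hj : w j = k - b • (w i - w j)) (hk : inner ℝ k (w i - w j) = 0)
    (hl : ∀ l, l ≠ i → l ≠ j → inner ℝ (w l) k < ‖k‖ ^ 2)
    (hji : Relation.ReflTransGen (Leads w) j i) : ∀ l ≠ i, ∃ m, Leads w l m := by
  set e := w i - w j with he
  have hnj : ‖w j‖ ^ 2 = ‖k‖ ^ 2 + b ^ 2 * ‖e‖ ^ 2 := by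
    rw [hj, norm_sub_sq_real, inner_smul_right, hk, norm_smul, mul_pow, Real.norm_eq_abs, sq_abs]
    ring
  have hnot : ¬ Leads w j i := by
    intro h
    rw [Leads, hnj, hi, hj, inner_add_left, inner_sub_right, inner_sub_right, inner_smul_left,
      inner_smul_left, inner_smul_right, inner_smul_right, hk, real_inner_comm k e, hk,
      real_inner_self_eq_norm_sq, real_inner_self_eq_norm_sq] at h
    simp only [conj_trivial] at h
    nlinarith [mul_nonneg (mul_pos ha hb).le (sq_nonneg ‖e‖), mul_nonneg (sq_nonneg b) (sq_nonneg ‖e‖)]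
  rcases Relation.ReflTransGen.cases_head hji with h | ⟨c, hjc, hci⟩
  · exact absurd h.symm hij
  -- the first step leads to the side of `w j`, from where `w i` cannot be reached directly
  have hcj : c ≠ j := fun h => lt_irrefl _ (h ▸ hjc).norm_lt
  have hc_i : c ≠ i := fun h => hnot (h ▸ hjc)
  have hce : inner ℝ (w c) e < 0 := by
    have h := hjc
    rw [Leads, hnj, hj, inner_sub_right, inner_smul_right] at h
    have := hl c hc_i hcj
    have h2 : b * inner ℝ (w c) e < 0 := by
      nlinarith [mul_nonneg (sq_nonneg b) (sq_nonneg ‖e‖)]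
    by_contra! hc
    linarith [mul_nonneg hb.le hc]
  rcases Relation.ReflTransGen.cases_head hci with h | ⟨d, hcd, hdi⟩
  · exact absurd h hc_i
  have hdc : d ≠ c := fun h => lt_irrefl _ (h ▸ hcd).norm_lt
  have hdj : d ≠ j := fun h => lt_asymm hjc.norm_lt (h ▸ hcd).norm_lt
  have hd_i : d ≠ i := by
    rintro rfl
    have h := hcd
    rw [Leads, hi, inner_add_left, inner_smul_left, real_inner_comm, real_inner_comm (w c) e] at h
    have h1 := hl c hc_i hcj
    have h2 : ‖w j‖ ^ 2 < ‖w c‖ ^ 2 := pow_lt_pow_left₀ hjc.norm_lt (norm_nonneg _) two_ne_zero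
    simp only [conj_trivial] at h
    nlinarith [mul_neg_of_pos_of_neg ha hce, mul_nonneg (sq_nonneg b) (sq_nonneg ‖e‖)]
  rcases Relation.ReflTransGen.cases_head hdi with h | ⟨f, hdf, -⟩
  · exact absurd h hd_i
  intro l hli
  have : l = j ∨ l = c ∨ l = d := by omega
  rcases this with rfl | rfl | rfl
  exacts [⟨_, hjc⟩, ⟨_, hcd⟩, ⟨_, hdf⟩]

/-- Let `k` be a point between `w i` and `w j` in which the plane perpendicular to `k` supports
the tetrahedron spanned by `w` along the edge `w i`, `w j`. If chains of leading vertices from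
both ends of this edge arrive at the same vertex `u`, then every vertex but `u` leads to
another one. -/
lemma exists_leads_of_chains {w : Fin 4 → E3} {i j : Fin 4} (hij : i ≠ j) {k : E3}
    {a b : ℝ} (ha : 0 < a) (hb : 0 < b) (hi : w i = k + a • (w i - w j))
    (hj : w j = k - b • (w i - w j)) (hk : inner ℝ k (w i - w j) = 0)
    (hl : ∀ l, l ≠ i → l ≠ j → inner ℝ (w l) k < ‖k‖ ^ 2) {u : Fin 4}
    (hiu : Relation.ReflTransGen (Leads w) i u) (hju : Relation.ReflTransGen (Leads w) j u) :
    ∀ l ≠ u, ∃ m, Leads w l m := by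
  have hi' : w i = k - a • (w j - w i) := by rw [← neg_sub (w i), smul_neg, sub_neg_eq_add]; exact hi
  have hj' : w j = k + b • (w j - w i) := by
    rw [← neg_sub (w i), smul_neg, ← sub_eq_add_neg]; exact hj
  have hk' : inner ℝ k (w j - w i) = 0 := by rw [← neg_sub, inner_neg_right, hk, neg_zero]
  by_cases hui : u = i
  · subst hui
    exact exists_leads_of_chain_to_end hij ha hb hi hj hk hl hju
  by_cases huj : u = j
  · subst huj
    exact exists_leads_of_chain_to_end hij.symm hb ha hj' hi' hk' (fun l h1 h2 => hl l h2 h1) hiu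
  -- the first step from either end changes the component along the edge in opposite directions
  have first : ∀ {p q : Fin 4} {s t : ℝ}, 0 < s → 0 < t → w p = k + s • (w p - w q) →
      w q = k - t • (w p - w q) → inner ℝ k (w p - w q) = 0 →
      (∀ l, l ≠ p → l ≠ q → inner ℝ (w l) k < ‖k‖ ^ 2) → ∀ c, Leads w p c →
      c ≠ q ∧ (c ≠ p → 0 < inner ℝ (w c) (w p - w q)) := by
    intro p q s t hs ht hp hq hpq hl c hc
    set e := w p - w q with he
    have hnp : ‖w p‖ ^ 2 = ‖k‖ ^ 2 + s ^ 2 * ‖e‖ ^ 2 := by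
      rw [hp, norm_add_sq_real, inner_smul_right, hpq, norm_smul, mul_pow, Real.norm_eq_abs, sq_abs]
      ring
    have hcq : c ≠ q := by
      rintro rfl
      rw [Leads, hnp, hp, hq, inner_sub_left, inner_add_right, inner_add_right, inner_smul_left,
        inner_smul_left, inner_smul_right, inner_smul_right, hpq, real_inner_comm k e, hpq,
        real_inner_self_eq_norm_sq, real_inner_self_eq_norm_sq] at hc
      simp only [conj_trivial] at hc
      nlinarith [mul_nonneg (mul_pos hs ht).le (sq_nonneg ‖e‖),
        mul_nonneg (sq_nonneg s) (sq_nonneg ‖e‖)]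
    refine ⟨hcq, fun hcp => ?_⟩
    have h1 := hl c hcp hcq
    rw [Leads, hnp, hp, inner_add_right, inner_smul_right] at hc
    have h2 : 0 < s * inner ℝ (w c) e := by
      nlinarith [mul_nonneg (sq_nonneg s) (sq_nonneg ‖e‖)]
    exact pos_of_mul_pos_right h2 hs.le
  rcases Relation.ReflTransGen.cases_head hiu with h | ⟨c, hic, hcu⟩
  · exact absurd h.symm hui
  rcases Relation.ReflTransGen.cases_head hju with h | ⟨d, hjd, hdu⟩
  · exact absurd h.symm huj
  have hci : c ≠ i := fun h => lt_irrefl _ (h ▸ hic).norm_lt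
  have hdj : d ≠ j := fun h => lt_irrefl _ (h ▸ hjd).norm_lt
  obtain ⟨hcj, hce⟩ := first ha hb hi hj hk hl c hic
  obtain ⟨hd_i, hde⟩ := first hb ha hj' hi' hk' (fun l h1 h2 => hl l h2 h1) d hjd
  have hcd : c ≠ d := by
    rintro rfl
    have h1 := hce hci
    have h2 := hde hdj
    rw [← neg_sub, inner_neg_right] at h2
    linarith
  intro l hlu
  rcases Relation.ReflTransGen.cases_head hcu with rfl | ⟨c', hcc, -⟩
  · rcases Relation.ReflTransGen.cases_head hdu with h | ⟨d', hdd, -⟩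
    · exact absurd h.symm hcd
    have : l = i ∨ l = j ∨ l = d := by omega
    rcases this with rfl | rfl | rfl
    exacts [⟨_, hic⟩, ⟨_, hjd⟩, ⟨_, hdd⟩]
  · rcases Relation.ReflTransGen.cases_head hdu with rfl | ⟨d', hdd, -⟩
    · have : l = i ∨ l = j ∨ l = c := by omega
      rcases this with rfl | rfl | rfl
      exacts [⟨_, hic⟩, ⟨_, hjd⟩, ⟨_, hcc⟩]
    · have : l = i ∨ l = j ∨ l = c ∨ l = d := by omega
      rcases this with rfl | rfl | rfl | rfl
      exacts [⟨_, hic⟩, ⟨_, hjd⟩, ⟨_, hcc⟩, ⟨_, hdd⟩]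

namespace Tetrahedron

variable {T : Tetrahedron} {o : E3}

/-! ### The flow from vertex to vertex -/

/-- Along a ray the flow keeps the same outer normal vector `ν` as residual, as long as the ray
does not leave `T`. -/
lemma IsTrap.union_segment_of_normal {M : Set E3} (hM : T.IsTrap o M) {x y ν : E3} (hy : y ∈ M)
    (hx : x ∈ T.body) {β : ℝ} (hβ : 0 ≤ β) (hxν : x - o = ν + β • (y - x))
    (hperp : inner ℝ ν (y - x) = 0) (hn : ∀ z ∈ T.body, inner ℝ ν (z - x) ≤ 0) {i : Fin 4}
    (hix : T.coord i x = 0) (hiy : T.coord i y = 0) : T.IsTrap o (segment ℝ x y ∪ M) := by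
  have hyb := (hM.2.1 y hy).1
  refine hM.union_segment hy fun c hc0 hc1 => ⟨?_, ⟨i, ?_⟩,
    ‖x + c • (y - x) - o‖⁻¹ * (β + c), by positivity, ?_⟩
  · exact T.convex_body.add_smul_sub_mem hx hyb ⟨hc0, hc1.le⟩
  · rw [coord_add, inner_smul_right, inner_coordGrad_sub, hix, hiy]; ring
  · rw [mul_smul]
    refine isResidualNormal_smul fun z hz => ?_
    have h1 : x + c • (y - x) - o - (β + c) • (y - x) = ν := by
      rw [show x + c • (y - x) - o = (x - o) + c • (y - x) by abel, hxν]; module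
    rw [h1, show z - (x + c • (y - x)) = (z - x) - c • (y - x) by abel, inner_sub_right,
      inner_smul_right, hperp, mul_zero, sub_zero]
    exact hn z hz

lemma eq_of_point_mem_segment {x : E3} {m j : Fin 4} (hm : T.points m ∈ segment ℝ x (T.points j))
    (hx : T.coord m x < 1) : m = j := by
  by_contra hmj
  rw [segment_eq_image'] at hm
  obtain ⟨c, ⟨h0, h1⟩, h⟩ := hm
  have := congrArg (T.coord m) h
  simp only at this
  rw [coord_add, inner_smul_right, inner_coordGrad_sub, coord_point_self,
    T.coord_point_of_ne hmj] at this
  have hc : c = 0 := le_antisymm (by nlinarith) h0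
  rw [hc] at this
  linarith

lemma point_sub_ne {i j : Fin 4} (hij : i ≠ j) : T.points j - T.points i ≠ 0 :=
  sub_ne_zero.2 fun h => hij (T.independent.injective h).symm

lemma leads_points_iff {i j : Fin 4} : Leads (fun m => T.points m - o) i j ↔
    0 < inner ℝ (T.points i - o) (T.points j - T.points i) := by
  rw [Leads, ← real_inner_self_eq_norm_sq, ← sub_pos, ← inner_sub_left, sub_sub_sub_cancel_right,
    real_inner_comm]

/-- A flow that starts at a vertex and runs through the interior of a face to the opposite edge
does not pass to the face beyond this edge, because `o` is an interior point. So it follows the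
edge to one of its ends, or the point of arrival is an equilibrium point. -/
lemma exists_trap_of_face_direction (ho : o ∈ interior T.body) {i j k l : Fin 4} (hij : i ≠ j)
    (hik : i ≠ k) (hil : i ≠ l) (hjk : j ≠ k) (hjl : j ≠ l) (hkl : k ≠ l) {v ν : E3}
    (hg : T.points i - o = ν + v) (hperp : inner ℝ ν v = 0)
    (hn : ∀ x ∈ T.body, inner ℝ ν (x - T.points i) ≤ 0) {b c : ℝ} (hb : 0 < b) (hc : 0 < c)
    (hv : v = b • (T.points j - T.points i) + c • (T.points k - T.points i))
    (hνj : inner ℝ ν (T.points j - T.points i) = 0)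
    (hνk : inner ℝ ν (T.points k - T.points i) = 0)
    (hδ : 0 ≤ inner ℝ v (T.points k - T.points j)) :
    Leads (fun m => T.points m - o) i k ∧ ∃ y, (∀ m, T.coord m y < 1) ∧
      ∀ M, T.IsTrap o M → T.points k ∈ M →
        T.IsTrap o (segment ℝ (T.points i) y ∪ {y}) ∨
          T.IsTrap o (segment ℝ (T.points i) y ∪ (segment ℝ y (T.points k) ∪ M)) := by
  set X := T.points i with hX
  set τ := T.points k - T.points j with hτ
  set s := (b + c)⁻¹ with hs
  have hs0 : 0 < s := by positivity
  have hsbc : s * (b + c) = 1 := inv_mul_cancel₀ (by positivity)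
  have hlast : ∀ m, m = i ∨ m = j ∨ m = k ∨ m = l := by omega
  have hv0 : v ≠ 0 := by
    intro h0
    have h1 : inner ℝ (T.coordGrad j) v = b := by
      rw [hv, inner_add_right, inner_smul_right, inner_smul_right, inner_coordGrad_sub,
        inner_coordGrad_sub, coord_point_self, T.coord_point_of_ne hij.symm,
        T.coord_point_of_ne hjk]; ring
    rw [h0, inner_zero_right] at h1
    exact hb.ne h1
  have hvn : 0 < ‖v‖ ^ 2 := by have := norm_pos_iff.2 hv0; positivity
  have hτ0 : 0 < ‖τ‖ ^ 2 := by have := norm_pos_iff.2 (point_sub_ne (T := T) hjk); positivity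
  have hτn : ‖τ‖ ≠ 0 := fun h => by rw [h] at hτ0; norm_num at hτ0
  have hντ : inner ℝ ν τ = 0 := by
    rw [hτ, show T.points k - T.points j = (T.points k - X) - (T.points j - X) by abel,
      inner_sub_right, hνj, hνk, sub_zero]
  have hleads : Leads (fun m => T.points m - o) i k := by
    rw [leads_points_iff, hg, inner_add_left, hνk, zero_add]
    have h1 : inner ℝ v v = b * inner ℝ v (T.points j - X) + c * inner ℝ v (T.points k - X) := by
      have := congrArg (inner ℝ v) hv
      rwa [inner_add_right, inner_smul_right, inner_smul_right] at this
    rw [real_inner_self_eq_norm_sq] at h1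
    have h2 : inner ℝ v τ = inner ℝ v (T.points k - X) - inner ℝ v (T.points j - X) := by
      rw [hτ, ← inner_sub_right]; congr 1; abel
    rw [h2] at hδ
    by_contra! hneg
    nlinarith
  set y := X + s • v with hy
  have hyX : y - X = s • v := by rw [hy]; abel
  -- the ray from the vertex hits the opposite edge here
  have hy' : y = T.points j + (s * c) • τ := by
    have : s * b = 1 - s * c := by linarith
    rw [hy, hv, smul_add, smul_smul, smul_smul, this, hτ]; module
  have hsc1 : s * c < 1 := by nlinarith
  have hseg : y ∈ segment ℝ (T.points j) (T.points k) := by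
    rw [segment_eq_image']; exact ⟨s * c, ⟨by positivity, hsc1.le⟩, hy'.symm⟩
  have hyb : y ∈ T.body := T.convex_body.segment_subset (T.point_mem_body j) (T.point_mem_body k) hseg
  have hcoord : ∀ m, T.coord m y = T.coord m (T.points j) +
      (s * c) * (T.coord m (T.points k) - T.coord m (T.points j)) := fun m => by
    rw [hy', coord_add, inner_smul_right, hτ, inner_coordGrad_sub]
  have hyi : T.coord i y = 0 := by
    rw [hcoord, T.coord_point_of_ne hij, T.coord_point_of_ne hik]; ring
  have hyl : T.coord l y = 0 := by
    rw [hcoord, T.coord_point_of_ne hjl.symm, T.coord_point_of_ne hkl.symm]; ring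
  have hyj1 : T.coord j y < 1 := by
    rw [hcoord, T.coord_point_of_ne hjk, coord_point_self]
    have : 0 < s * c := by positivity
    linarith
  have hyk1 : T.coord k y < 1 := by
    rw [hcoord, T.coord_point_of_ne hjk.symm, coord_point_self]; linarith
  have hfirst : ∀ {N : Set E3}, T.IsTrap o N → y ∈ N → T.IsTrap o (segment ℝ X y ∪ N) := by
    intro N hN hyN
    refine hN.union_segment_of_normal hyN (T.point_mem_body i) (β := b + c) (ν := ν) (by positivity)
      ?_ ?_ hn (T.coord_point_of_ne hil.symm) hyl
    · rw [hyX, smul_smul, mul_comm, hsbc, one_smul, hg]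
    · rw [hyX, inner_smul_right, hperp, mul_zero]
  -- the residual after projection onto the edge
  set β := (1 + s) * (inner ℝ v τ / ‖τ‖ ^ 2) with hβ
  set ν' := ν + (1 + s) • v - β • τ with hν'
  have hβ0 : 0 ≤ β := by positivity
  have hyo : y - o = ν' + β • τ := by
    rw [hν', show y - o = (X - o) + s • v by rw [hy]; abel, hg]; module
  have hν'τ : inner ℝ ν' τ = 0 := by
    rw [hν', inner_sub_left, inner_add_left, inner_smul_left, inner_smul_left, hντ,
      real_inner_self_eq_norm_sq, hβ]
    simp only [conj_trivial]; field_simp; ring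
  have hQ : 0 ≤ inner ℝ ν' v := by
    have hcs := real_inner_mul_inner_self_le v τ
    rw [real_inner_self_eq_norm_sq, real_inner_self_eq_norm_sq] at hcs
    have : inner ℝ ν' v = (1 + s) * ((‖v‖ ^ 2 * ‖τ‖ ^ 2 - inner ℝ v τ * inner ℝ v τ) / ‖τ‖ ^ 2) := by
      rw [hν', inner_sub_left, inner_add_left, inner_smul_left, inner_smul_left, hperp,
        real_inner_self_eq_norm_sq, hβ, real_inner_comm v τ]
      simp only [conj_trivial]; field_simp; ring
    rw [this]
    exact mul_nonneg (by positivity) (div_nonneg (by linarith) hτ0.le)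
  have hν'i : inner ℝ ν' (X - y) = -(s * inner ℝ ν' v) := by
    rw [← neg_sub, hyX, inner_neg_right, inner_smul_right]
  have hν'k : inner ℝ ν' (T.points k - y) = 0 := by
    rw [show T.points k - y = (1 - s * c) • τ by rw [hy', hτ]; module, inner_smul_right, hν'τ,
      mul_zero]
  have hν'j : inner ℝ ν' (T.points j - y) = 0 := by
    rw [show T.points j - y = (-(s * c)) • τ by rw [hy', hτ]; module, inner_smul_right, hν'τ,
      mul_zero]
  -- the vector `ν'` does not point beyond the edge: evaluated at the interior point `o`, a
  -- positive value at vertex `l` would be too large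
  have hν'l : inner ℝ ν' (T.points l - y) ≤ 0 := by
    have hsum := T.inner_sub_eq_sum ν' o y
    have huniv : (Finset.univ : Finset (Fin 4)) = {i, j, k, l} := by
      ext m; simpa using hlast m
    rw [huniv, Finset.sum_insert (by simp [hij, hik, hil]), Finset.sum_insert (by simp [hjk, hjl]),
      Finset.sum_pair hkl, ← hX, hν'i, hν'j, hν'k, ← neg_sub y o, inner_neg_right, hyo,
      inner_add_right, inner_smul_right, hν'τ, real_inner_self_eq_norm_sq] at hsum
    have hνν' : inner ℝ ν' ν = ‖ν‖ ^ 2 := by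
      rw [hν', inner_sub_left, inner_add_left, inner_smul_left, inner_smul_left,
        real_inner_self_eq_norm_sq, real_inner_comm ν v, hperp, real_inner_comm ν τ, hντ]; simp
    have hnn : ‖ν'‖ ^ 2 = ‖ν‖ ^ 2 + (1 + s) * inner ℝ ν' v := by
      rw [← real_inner_self_eq_norm_sq]
      conv_lhs => rw [show inner ℝ ν' ν' = inner ℝ ν' (ν + (1 + s) • v - β • τ) from rfl]
      rw [inner_sub_right, inner_add_right, inner_smul_right, inner_smul_right, hν'τ, hνν']; ring
    have hi1 : T.coord i o ≤ 1 := by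
      have := T.sum_coord o
      rw [← this]
      exact Finset.single_le_sum (fun m _ => (T.coord_pos_of_mem_interior ho m).le)
        (Finset.mem_univ i)
    have hl0 := T.coord_pos_of_mem_interior ho l
    have hi0 := T.coord_pos_of_mem_interior ho i
    by_contra! hpos
    nlinarith [mul_pos hl0 hpos, mul_nonneg hs0.le hQ, sq_nonneg ‖ν‖,
      mul_nonneg (sub_nonneg.2 hi1) (mul_nonneg hs0.le hQ)]
  have hn' : ∀ x ∈ T.body, inner ℝ ν' (x - y) ≤ 0 := by
    intro x hx
    rw [T.inner_sub_eq_sum]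
    refine Finset.sum_nonpos fun m _ => mul_nonpos_of_nonneg_of_nonpos (T.mem_body_iff.1 hx m) ?_
    rcases hlast m with rfl | rfl | rfl | rfl
    · rw [← hX, hν'i]; have := mul_nonneg hs0.le hQ; linarith
    · exact hν'j.le
    · exact hν'k.le
    · exact hν'l
  refine ⟨hleads, y, fun m => ?_, fun M hM hk => ?_⟩
  · rcases hlast m with rfl | rfl | rfl | rfl
    exacts [hyi ▸ one_pos, hyj1, hyk1, hyl ▸ one_pos]
  rcases hδ.eq_or_lt with h0 | hpos
  · left
    have hb0 : β = 0 := by rw [hβ, ← h0]; simp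
    refine hfirst ?_ rfl
    refine IsEquilibrium.isTrap ⟨hyb, ne_of_coord_eq_zero ho hyi, fun x hx => ?_⟩ hyi
    rw [hyo, hb0, zero_smul, add_zero, real_inner_comm]
    exact hn' x hx
  · right
    have hky : T.points k - y = (1 - s * c) • τ := by rw [hy', hτ]; module
    have h1 : 0 < 1 - s * c := by linarith
    refine hfirst ?_ (Or.inl (left_mem_segment ℝ _ _))
    refine hM.union_segment_of_normal hk hyb (β := β / (1 - s * c)) (by positivity) ?_ hν'k hn' hyi
      (T.coord_point_of_ne hik)
    rw [hyo, hky, smul_smul, div_mul_cancel₀ _ h1.ne']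

/-- From every vertex the ascending flow is confined to a set that contains no vertices but
those at the end of chains along which the distance from `o` grows. -/
lemma exists_trap_of_vertex (ho : o ∈ interior T.body) (i : Fin 4) :
    ∃ M, T.IsTrap o M ∧ T.points i ∈ M ∧ ∀ m, T.points m ∈ M →
      Relation.ReflTransGen (Leads fun m => T.points m - o) i m := by
  induction i using (wellFounded_leads fun m => T.points m - o).induction with
  | _ i ih =>
  obtain ⟨v, hv, hperp, hn⟩ := T.exists_tangentCone_projection (T.points i) (T.points i - o)
  have hXi : ∀ m ≠ i, T.coord m (T.points i) = 0 := fun m hm => T.coord_point_of_ne hm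
  have hc0 : ∀ m ≠ i, 0 ≤ inner ℝ (T.coordGrad m) v := fun m hm => hv m (hXi m hm)
  have hXo : T.points i ≠ o := by
    obtain ⟨m, hm⟩ : ∃ m, m ≠ i := ⟨i + 1, by omega⟩
    exact ne_of_coord_eq_zero ho (hXi m hm)
  set ν := T.points i - o - v with hν
  have hg : T.points i - o = ν + v := by rw [hν]; abel
  have hνm : ∀ m, 0 < inner ℝ (T.coordGrad m) v → inner ℝ ν (T.points m - T.points i) = 0 :=
    fun m hm => inner_residual_eq_zero (T.point_mem_body i) hv hperp hn (Or.inr hm)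
  have hvsum := T.sum_inner_coordGrad_smul (T.points i) v
  by_cases hv0 : v = 0
  · obtain ⟨m, hm⟩ : ∃ m, m ≠ i := ⟨i + 1, by omega⟩
    refine ⟨{T.points i}, IsEquilibrium.isTrap ⟨T.point_mem_body i, hXo, fun x hx => ?_⟩ (hXi m hm),
      rfl, fun m hm => ?_⟩
    · have := hn x hx
      rwa [hg, hv0, add_zero, real_inner_comm]
    · rw [T.independent.injective hm]
  obtain ⟨j, hji, hj⟩ : ∃ j, j ≠ i ∧ 0 < inner ℝ (T.coordGrad j) v := by
    by_contra! hcon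
    apply hv0
    rw [← hvsum]
    refine Finset.sum_eq_zero fun m _ => ?_
    by_cases hm : m = i
    · rw [hm, sub_self, smul_zero]
    · rw [le_antisymm (hcon m hm) (hc0 m hm), zero_smul]
  by_cases hex : ∃ k, k ≠ i ∧ k ≠ j ∧ 0 < inner ℝ (T.coordGrad k) v
  · obtain ⟨k, hki, hkj, hk⟩ := hex
    obtain ⟨l, hli, hlj, hlk⟩ : ∃ l, l ≠ i ∧ l ≠ j ∧ l ≠ k :=
      (by decide : ∀ i j k : Fin 4, ∃ l, l ≠ i ∧ l ≠ j ∧ l ≠ k) i j k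
    have huniv : (Finset.univ : Finset (Fin 4)) = {i, j, k, l} := by
      ext m
      have : m = i ∨ m = j ∨ m = k ∨ m = l := by omega
      simpa using this
    have hl : inner ℝ (T.coordGrad l) v = 0 := by
      by_contra hne
      have hpos := lt_of_le_of_ne (hc0 l hli) (Ne.symm hne)
      have h0 : ν = 0 := eq_zero_of_inner_points (T := T) (p := T.points i) fun m => by
        have : m = i ∨ m = j ∨ m = k ∨ m = l := by omega
        rcases this with rfl | rfl | rfl | rfl
        exacts [by rw [sub_self, inner_zero_right], hνm _ hj, hνm _ hk, hνm _ hpos]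
      rw [h0, zero_add] at hg
      rw [← hg] at hj
      exact lt_asymm hj (inner_coordGrad_radial_neg ho (hXi j hji))
    have hvjk : v = inner ℝ (T.coordGrad j) v • (T.points j - T.points i) +
        inner ℝ (T.coordGrad k) v • (T.points k - T.points i) := by
      conv_lhs => rw [← hvsum]
      rw [huniv, Finset.sum_insert (by simp [hji.symm, hki.symm, hli.symm]),
        Finset.sum_insert (by simp [hkj.symm, hlj.symm]), Finset.sum_pair hlk.symm, hl, sub_self]
      simp
    have finish : ∀ q, Leads (fun m => T.points m - o) i q → (∃ y, (∀ m, T.coord m y < 1) ∧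
        ∀ M, T.IsTrap o M → T.points q ∈ M →
          T.IsTrap o (segment ℝ (T.points i) y ∪ {y}) ∨
            T.IsTrap o (segment ℝ (T.points i) y ∪ (segment ℝ y (T.points q) ∪ M))) →
        ∃ M, T.IsTrap o M ∧ T.points i ∈ M ∧ ∀ m, T.points m ∈ M →
          Relation.ReflTransGen (Leads fun m => T.points m - o) i m := by
      rintro q hq ⟨y, hy1, hy⟩
      obtain ⟨M, hM, hqM, hMc⟩ := ih q hq
      have hfirst : ∀ m, T.points m ∈ segment ℝ (T.points i) y →
          Relation.ReflTransGen (Leads fun m => T.points m - o) i m := fun m hm => by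
        rw [segment_symm] at hm
        rw [eq_of_point_mem_segment hm (hy1 m)]
      rcases hy M hM hqM with h | h
      · refine ⟨_, h, Or.inl (left_mem_segment ℝ _ _), fun m hm => ?_⟩
        rcases hm with hm | hm
        · exact hfirst m hm
        · have h1 := hy1 m
          rw [← Set.mem_singleton_iff.1 hm, coord_point_self] at h1
          exact absurd h1 (lt_irrefl _)
      · refine ⟨_, h, Or.inl (left_mem_segment ℝ _ _), fun m hm => ?_⟩
        rcases hm with hm | hm | hm
        · exact hfirst m hm
        · rw [eq_of_point_mem_segment hm (hy1 m)]
          exact Relation.ReflTransGen.single hq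
        · exact Relation.ReflTransGen.head hq (hMc m hm)
    rcases le_total 0 (inner ℝ v (T.points k - T.points j)) with hδ | hδ
    · obtain ⟨h1, h2⟩ := exists_trap_of_face_direction ho hji.symm hki.symm hli.symm hkj.symm
        hlj.symm hlk.symm hg hperp hn hj hk hvjk (hνm j hj) (hνm k hk) hδ
      exact finish k h1 h2
    · have hδ' : 0 ≤ inner ℝ v (T.points j - T.points k) := by
        rw [← neg_sub, inner_neg_right]; linarith
      obtain ⟨h1, h2⟩ := exists_trap_of_face_direction ho hki.symm hji.symm hli.symm hkj
        hlk.symm hlj.symm hg hperp hn hk hj (by rw [add_comm]; exact hvjk) (hνm k hk) (hνm j hj) hδ'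
      exact finish j h1 h2
  · push Not at hex
    have hvj : v = inner ℝ (T.coordGrad j) v • (T.points j - T.points i) := by
      conv_lhs => rw [← hvsum]
      refine Finset.sum_eq_single j (fun m _ hm => ?_) (by simp)
      by_cases hmi : m = i
      · rw [hmi, sub_self, smul_zero]
      · rw [le_antisymm (hex m hmi hm) (hc0 m hmi), zero_smul]
    have hleads : Leads (fun m => T.points m - o) i j := by
      rw [leads_points_iff, hg, inner_add_left, hνm j hj, zero_add]
      have h1 := congrArg (inner ℝ v) hvj
      rw [inner_smul_right, real_inner_self_eq_norm_sq] at h1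
      have h2 : 0 < ‖v‖ ^ 2 := by have := norm_pos_iff.2 hv0; positivity
      rw [h1] at h2
      exact pos_of_mul_pos_right h2 hj.le
    obtain ⟨M, hM, hjM, hMc⟩ := ih j hleads
    obtain ⟨l, hli, hlj⟩ : ∃ l, l ≠ i ∧ l ≠ j :=
      (by decide : ∀ i j : Fin 4, ∃ l, l ≠ i ∧ l ≠ j) i j
    refine ⟨_, hM.union_segment_of_normal hjM (T.point_mem_body i) hj.le (by rw [← hvj]; exact hg)
      (hνm j hj) hn (hXi l hli) (T.coord_point_of_ne hlj), Or.inl (left_mem_segment ℝ _ _),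
      fun m hm => ?_⟩
    rcases hm with hm | hm
    · by_cases hmi : m = i
      · rw [hmi]
      · rw [eq_of_point_mem_segment hm (by rw [hXi m hmi]; exact one_pos)]
        exact Relation.ReflTransGen.single hleads
    · exact Relation.ReflTransGen.head hleads (hMc m hm)

end Tetrahedron

/-! ### Tracing ascending curves backwards through the faces -/

/-- A function with non-negative right derivative does not decrease. -/
lemma le_of_hasDerivWithinAt_right_nonneg {f : ℝ → ℝ} {a b : ℝ} (hab : a ≤ b)
    (hf : ContinuousOn f (Set.Icc a b))
    (hd : ∀ t ∈ Set.Ico a b, ∃ d, 0 ≤ d ∧ HasDerivWithinAt f d (Set.Ici t) t) : f a ≤ f b := by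
  choose! d hd0 hd using hd
  exact image_le_of_deriv_right_le_deriv_boundary (f := fun _ => f a) (f' := fun _ => 0)
    continuousOn_const (fun t _ => hasDerivWithinAt_const _ _ _) le_rfl hf hd hd0
    (Set.right_mem_Icc.2 hab)

namespace Tetrahedron

variable {T : Tetrahedron} {o : E3}

lemma hasDerivWithinAt_coord {γ : ℝ → E3} {v : E3} {s : Set ℝ} {t : ℝ}
    (hd : HasDerivWithinAt γ v s t) (i : Fin 4) :
    HasDerivWithinAt (fun r => T.coord i (γ r)) (inner ℝ (T.coordGrad i) v) s t := by
  have h1 := (hasDerivWithinAt_const t s (T.coordGrad i)).inner ℝ hd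
  have h2 : (fun r => T.coord i (γ r)) =
      fun r => T.coord i 0 + inner ℝ (T.coordGrad i) (γ r) := by
    funext r; simpa using T.coord_eq_add_inner i (γ r) 0
  rw [h2]
  simpa using h1.const_add (T.coord i 0)

/-- `p` lies in the relative interior of the face opposite vertex `j`. -/
def OnFace (T : Tetrahedron) (j : Fin 4) (p : E3) : Prop :=
  T.coord j p = 0 ∧ ∀ i ≠ j, 0 < T.coord i p

/-- The point with parameter `ρ` on the ray from the foot of face `i` through `q`. -/
noncomputable def rayPoint (T : Tetrahedron) (o : E3) (i : Fin 4) (q : E3) (ρ : ℝ) : E3 :=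
  T.foot o i + ρ • (q - T.foot o i)

lemma coord_rayPoint (i j : Fin 4) (q : E3) (ρ : ℝ) : T.coord j (T.rayPoint o i q ρ) =
    T.coord j (T.foot o i) + ρ * (T.coord j q - T.coord j (T.foot o i)) := by
  rw [rayPoint, coord_add, inner_smul_right, inner_coordGrad_sub]

/-- `BackPath T o i q N l` says that, tracing the flow backwards from `q` into the interior of
face `i`, one obtains the set `N` and ends at the foot of face `l`. In each face the path
follows the ray from the foot of this face; it changes from face `i` to face `j` in an interior
point of their common edge, and then the foot of face `i` lies beyond face `j`. -/
inductive BackPath (T : Tetrahedron) (o : E3) : Fin 4 → E3 → Set E3 → Fin 4 → Prop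
  | last (i : Fin 4) (q : E3)
      (hseg : ∀ ρ : ℝ, 0 < ρ → ρ < 1 → T.OnFace i (T.rayPoint o i q ρ)) :
      BackPath T o i q (T.rayPoint o i q '' Set.Ioc 0 1) i
  | step (i j l : Fin 4) (q : E3) (N : Set E3) (ρ₀ : ℝ) (h0 : 0 < ρ₀) (h1 : ρ₀ < 1)
      (hseg : ∀ ρ : ℝ, ρ₀ < ρ → ρ < 1 → T.OnFace i (T.rayPoint o i q ρ))
      (hij : Leads (T.polar o) i j) (hj : T.coord j (T.rayPoint o i q ρ₀) = 0)
      (hpos : ∀ k, k ≠ i → k ≠ j → 0 < T.coord k (T.rayPoint o i q ρ₀))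
      (hN : BackPath T o j (T.rayPoint o i q ρ₀) N l) :
      BackPath T o i q (T.rayPoint o i q '' Set.Ioc ρ₀ 1 ∪ N) l

lemma BackPath.reflTransGen {i l : Fin 4} {q : E3} {N : Set E3} (h : T.BackPath o i q N l) :
    Relation.ReflTransGen (Leads (T.polar o)) i l := by
  induction h with
  | last => exact .refl
  | step i j l q N ρ₀ _ _ _ hij _ _ _ ih => exact .head hij ih

/-- Tracing the flow backwards is deterministic as long as no vertex is met. -/
lemma BackPath.unique {i l l' : Fin 4} {q : E3} {N N' : Set E3} (h : T.BackPath o i q N l)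
    (h' : T.BackPath o i q N' l') : N = N' := by
  induction h generalizing N' l' with
  | last i q hseg =>
    cases h' with
    | last => rfl
    | step _ j _ _ N ρ₀ h0 h1 _ hij hj =>
      exact absurd hj ((hseg ρ₀ h0 h1).2 j hij.ne).ne'
  | step i j l q N ρ₀ h0 h1 hseg hij hj hpos hN ih =>
    cases h' with
    | last _ _ hseg' => exact absurd hj ((hseg' ρ₀ h0 h1).2 j hij.ne).ne'
    | step _ j' _ _ N₁ ρ₁ h0' h1' hseg' hij' hj' _ hN' =>
      rcases lt_trichotomy ρ₀ ρ₁ with hlt | rfl | hlt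
      · exact absurd hj' ((hseg ρ₁ hlt h1').2 j' hij'.ne).ne'
      · obtain rfl : j' = j := by
          by_contra hne
          exact (hpos j' hij'.ne hne).ne' hj'
        rw [ih hN']
      · exact absurd hj ((hseg' ρ₀ hlt h1).2 j hij.ne).ne'

/-- A continuous curve that follows the extended gradient during the times of an interval `I`
that contains no positive times and is open below, and tends to `x` at the lower end of `I`. -/
structure IsCurveFrom (T : Tetrahedron) (o x : E3) (I : Set ℝ) (γ : ℝ → E3) : Prop where
  ordConnected : I.OrdConnected
  nonpos : ∀ t ∈ I, t ≤ 0
  continuousOn : ContinuousOn γ I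
  deriv : ∀ t ∈ I, t < 0 → ∃ v, T.IsExtendedGradient o (γ t) v ∧
    HasDerivWithinAt γ v (Set.Ici t) t
  tendsto : ∀ ε : ℝ, 0 < ε → ∃ t₀ ∈ I, ∀ t ∈ I, t ≤ t₀ → dist (γ t) x < ε
  exists_lt : ∀ t ∈ I, ∃ t' ∈ I, t' < t

/-- The time interval of an ascending curve is open below: the curve would start at its origin
otherwise, where there is no extended gradient. -/
lemma IsAscendingCurve.exists_isCurveFrom {x y : E3} {C : Set E3}
    (h : T.IsAscendingCurve o x y C) : T.IsEquilibrium o x ∧ T.IsEquilibrium o y ∧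
      ∃ I γ, T.IsCurveFrom o x I γ ∧ 0 ∈ I ∧ γ 0 = y ∧ C = γ '' I := by
  obtain ⟨hx, hy, I, γ, hI, h0, ⟨t₁, ht₁, hneg⟩, hc, hd, hl, hγ, hC⟩ := h
  refine ⟨hx, hy, I, γ, ⟨hI, h0.2, hc, hd, hl, ?_⟩, h0.1, hγ, hC⟩
  intro t ht
  by_contra! hmin
  have hγx : γ t = x := by
    refine eq_of_forall_dist_le fun ε hε => ?_
    obtain ⟨t₀, ht₀, h⟩ := hl ε hε
    exact (h t ht (hmin t₀ ht₀)).le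
  obtain ⟨v, hv, -⟩ := hd t ht ((hmin t₁ ht₁).trans_lt hneg)
  rw [hγx] at hv
  exact hx.not_isExtendedGradient hv

lemma IsCurveFrom.isAscendingOn {x : E3} {I : Set ℝ} {γ : ℝ → E3} (h : T.IsCurveFrom o x I γ)
    {a b : ℝ} (ha : a ∈ I) (hb : b ∈ I) : T.IsAscendingOn o γ a b :=
  ⟨h.continuousOn.mono (h.ordConnected.out ha hb), fun t ht => h.deriv t
    (h.ordConnected.out ha hb ⟨ht.1, ht.2.le⟩) (ht.2.trans_le (h.nonpos b hb))⟩

lemma IsCurveFrom.eventually {x : E3} {I : Set ℝ} {γ : ℝ → E3} (h : T.IsCurveFrom o x I γ)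
    {U : Set E3} (hU : U ∈ nhds x) : ∃ t₀ ∈ I, ∀ t ∈ I, t ≤ t₀ → γ t ∈ U := by
  obtain ⟨ε, hε, hb⟩ := Metric.mem_nhds_iff.1 hU
  obtain ⟨t₀, ht₀, h'⟩ := h.tendsto ε hε
  exact ⟨t₀, ht₀, fun t ht hle => hb (h' t ht hle)⟩

/-- Inside a face the flow runs along rays from the foot of the face. -/
lemma IsAscendingOn.eq_rayPoint (ho : o ∈ interior T.body) {γ : ℝ → E3} {a b : ℝ} (hab : a < b)
    (hγ : T.IsAscendingOn o γ a b) {i : Fin 4} (hi : ∀ t ∈ Set.Ico a b, T.OnFace i (γ t)) :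
    ‖γ a - T.foot o i‖ ≤ ‖γ b - T.foot o i‖ ∧ 0 < ‖γ a - T.foot o i‖ ∧
      γ a = T.rayPoint o i (γ b) (‖γ a - T.foot o i‖ / ‖γ b - T.foot o i‖) := by
  set p := T.foot o i with hp
  obtain ⟨hc, hd⟩ := hγ
  have hd' : ∀ t ∈ Set.Ico a b, γ t ≠ p ∧
      HasDerivWithinAt γ (‖γ t - o‖⁻¹ • (γ t - p)) (Set.Ici t) t := by
    intro t ht
    obtain ⟨v, hv, hdv⟩ := hd t ht
    have hveq := hv.eq_of_face ho (hi t ht).1 fun j hj h0 => absurd h0 ((hi t ht).2 j hj).ne'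
    refine ⟨fun h => hv.1 ?_, hveq ▸ hdv⟩
    rw [hveq, ← hp, h, sub_self, smul_zero]
  have hGd : ∀ t ∈ Set.Ico a b, HasDerivWithinAt (fun s => ‖γ s - p‖ ^ 2)
      (2 * (‖γ t - o‖⁻¹ * ‖γ t - p‖ ^ 2)) (Set.Ici t) t := by
    intro t ht
    have := ((hd' t ht).2.sub_const p).norm_sq
    rwa [inner_smul_right, real_inner_self_eq_norm_sq] at this
  have hmono : ∀ t ∈ Set.Icc a b, ‖γ a - p‖ ≤ ‖γ t - p‖ := by
    intro t ht
    refine le_of_sq_le_sq ?_ (norm_nonneg _)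
    refine le_of_hasDerivWithinAt_right_nonneg (f := fun s => ‖γ s - p‖ ^ 2) ht.1
      (((hc.mono (Set.Icc_subset_Icc_right ht.2)).sub continuousOn_const).norm.pow 2) fun s hs =>
      ⟨_, ?_, hGd s ⟨hs.1, hs.2.trans_le ht.2⟩⟩
    positivity
  have hap : 0 < ‖γ a - p‖ :=
    norm_pos_iff.2 (sub_ne_zero.2 (hd' a ⟨le_rfl, hab⟩).1)
  have hne : ∀ t ∈ Set.Icc a b, ‖γ t - p‖ ≠ 0 := fun t ht => (hap.trans_le (hmono t ht)).ne'
  have hconst := constant_of_has_deriv_right_zero (f := fun t => ‖γ t - p‖⁻¹ • (γ t - p))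
    (a := a) (b := b) (ContinuousOn.smul ((hc.sub continuousOn_const).norm.inv₀ hne)
      (hc.sub continuousOn_const)) (fun t ht => by
      have hnt := hne t ⟨ht.1, ht.2.le⟩
      have hN : HasDerivWithinAt (fun s => ‖γ s - p‖) (‖γ t - o‖⁻¹ * ‖γ t - p‖) (Set.Ici t) t := by
        have := (hGd t ht).sqrt (by positivity)
        simp only [Real.sqrt_sq (norm_nonneg _)] at this
        convert this using 1
        field_simp
      have : HasDerivWithinAt (fun s => ‖γ s - p‖⁻¹ • (γ s - p))
          (‖γ t - p‖⁻¹ • ‖γ t - o‖⁻¹ • (γ t - p) +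
            (-(‖γ t - o‖⁻¹ * ‖γ t - p‖) / ‖γ t - p‖ ^ 2) • (γ t - p)) (Set.Ici t) t :=
        (hN.inv hnt).smul ((hd' t ht).2.sub_const p)
      have hz : ‖γ t - p‖⁻¹ • ‖γ t - o‖⁻¹ • (γ t - p) +
          (-(‖γ t - o‖⁻¹ * ‖γ t - p‖) / ‖γ t - p‖ ^ 2) • (γ t - p) = 0 := by
        rw [smul_smul, ← add_smul]
        convert zero_smul ℝ (γ t - p) using 2
        field_simp
        ring
      rw [hz] at this
      exact this) b ⟨hab.le, le_rfl⟩
  refine ⟨hmono b ⟨hab.le, le_rfl⟩, hap, ?_⟩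
  rw [rayPoint, div_eq_mul_inv, mul_smul, ← hp,
    show ‖γ b - p‖⁻¹ • (γ b - p) = ‖γ a - p‖⁻¹ • (γ a - p) from hconst, smul_smul,
    mul_inv_cancel₀ hap.ne', one_smul]
  abel

/-- A stable equilibrium point is the foot of its face. -/
lemma IsStable.exists_foot (ho : o ∈ interior T.body) {x : E3} (hx : T.IsStable o x) :
    ∃ l, x = T.foot o l ∧ T.OnFace l x := by
  obtain ⟨s, hs, heq, hopen, hcontact⟩ := hx
  have hsc : sᶜ.card = 1 := by rw [Finset.card_compl, hs]; rfl
  obtain ⟨l, hl⟩ := Finset.card_eq_one.1 hsc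
  have hmem : ∀ i, i ∉ s ↔ i = l := fun i => by
    rw [← Finset.mem_compl, hl, Finset.mem_singleton]
  obtain ⟨hpos, hzero⟩ := T.mem_openFace_iff.1 hopen
  have hxl : T.coord l x = 0 := hzero l ((hmem l).2 rfl)
  refine ⟨l, ?_, hxl, fun i hi => hpos i (by by_contra h; exact hi ((hmem i).1 h))⟩
  have h1 : inner ℝ (x - o) (x - T.foot o l) = 0 := by
    rw [← T.sum_inner_coordGrad_smul x (x - T.foot o l), inner_sum]
    refine Finset.sum_eq_zero fun i _ => ?_
    rw [inner_smul_right]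
    by_cases hi : i = l
    · rw [hi, inner_coordGrad_sub, hxl, coord_foot_self ho]; simp
    · have his : i ∈ s := by by_contra h; exact hi ((hmem i).1 h)
      have hmem : T.points i ∈ T.contactSet o x := by rw [hcontact]; exact T.point_mem_closedFace his
      rw [real_inner_comm (T.points i - x) (x - o), hmem.2, mul_zero]
  have h2 : inner ℝ (T.foot o l - o) (x - T.foot o l) = 0 := by
    rw [inner_foot_sub ho, hxl, coord_foot_self ho, sub_self, mul_zero]
  have h3 : inner ℝ (x - T.foot o l) (x - T.foot o l) = 0 := by
    rw [show x - T.foot o l = (x - o) - (T.foot o l - o) by abel, inner_sub_left]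
    rw [show (x - o) - (T.foot o l - o) = x - T.foot o l by abel, h1, h2, sub_zero]
  exact sub_eq_zero.1 (inner_self_eq_zero.1 h3)

lemma isEquilibrium_foot (ho : o ∈ interior T.body) {i : Fin 4} (hi : T.foot o i ∈ T.body) :
    T.IsEquilibrium o (T.foot o i) := by
  refine ⟨hi, ne_of_coord_eq_zero ho (coord_foot_self ho i), fun y hy => ?_⟩
  rw [real_inner_comm, inner_foot_sub ho, coord_foot_self ho, zero_sub]
  have h1 := T.coord_pos_of_mem_interior ho i
  have h2 := T.mem_body_iff.1 hy i
  exact mul_nonpos_of_nonneg_of_nonpos (by positivity) (by linarith)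

/-- Backwards from a point on an edge across which the flow enters face `i`, a trajectory runs
in the interior of the face `j` on the other side of the edge. -/
lemma IsAscendingOn.onFace_of_crossing (ho : o ∈ interior T.body) {γ : ℝ → E3} {a b : ℝ}
    (hγ : T.IsAscendingOn o γ a b) {i j : Fin 4}
    (hj : T.coord j (γ b) = 0) (hfoot : T.coord j (T.foot o i) < 0)
    (hpos : ∀ t ∈ Set.Icc a b, ∀ k, k ≠ i → k ≠ j → 0 < T.coord k (γ t)) :
    ∀ t ∈ Set.Ico a b, T.OnFace j (γ t) := by
  intro t ht
  have hbody : ∀ s ∈ Set.Ico a b, ∀ k, 0 ≤ T.coord k (γ s) := fun s hs => by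
    obtain ⟨v, hv, -⟩ := hγ.2 s hs
    exact T.mem_body_iff.1 hv.2.1.exists_coord_eq_zero.1
  have hface : ∀ s ∈ Set.Ico a b, 0 < T.coord i (γ s) → T.OnFace j (γ s) := by
    intro s hs hi
    have hk : ∀ k ≠ j, 0 < T.coord k (γ s) := fun k hkj => by
      by_cases hki : k = i
      · exact hki ▸ hi
      · exact hpos s ⟨hs.1, hs.2.le⟩ k hki hkj
    obtain ⟨v, hv, -⟩ := hγ.2 s hs
    obtain ⟨-, m, hm⟩ := hv.2.1.exists_coord_eq_zero
    by_cases hmj : m = j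
    · exact ⟨hmj ▸ hm, hk⟩
    · exact absurd hm (hk m hmj).ne'
  refine hface t ht (lt_of_le_of_ne (hbody t ht i) fun hi => ?_)
  -- the coordinate `j` never decreases, and it grows where the coordinate `i` vanishes
  have hderiv : ∀ s ∈ Set.Ico a b, ∃ d, 0 ≤ d ∧ (T.coord i (γ s) = 0 → 0 < d) ∧
      HasDerivWithinAt (fun s => T.coord j (γ s)) d (Set.Ici s) s := by
    intro s hs
    obtain ⟨v, hv, hd⟩ := hγ.2 s hs
    have hdj : HasDerivWithinAt (fun s => T.coord j (γ s)) (inner ℝ (T.coordGrad j) v)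
        (Set.Ici s) s := hasDerivWithinAt_coord hd j
    rcases (hbody s hs i).eq_or_lt with h0 | h0
    · have hin : ∀ m ≠ i, T.coord m (γ s) = 0 → T.coord m (T.foot o i) ≤ 0 := fun m hm hm0 => by
        by_cases hmj : m = j
        · exact hmj ▸ hfoot.le
        · exact absurd hm0 (hpos s ⟨hs.1, hs.2.le⟩ m hm hmj).ne'
      have hveq := hv.eq_of_face ho h0.symm hin
      have hdpos : 0 < inner ℝ (T.coordGrad j) v := by
        have hr : 0 < ‖γ s - o‖ := norm_pos_iff.2 (sub_ne_zero.2 (ne_of_coord_eq_zero ho h0.symm))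
        rw [hveq, inner_smul_right, inner_coordGrad_sub]
        have := hbody s hs j
        exact mul_pos (by positivity) (by linarith)
      exact ⟨_, hdpos.le, fun _ => hdpos, hdj⟩
    · have := hv.inner_coordGrad (hface s hs h0).2
      rw [this] at hdj
      exact ⟨0, le_rfl, fun h => absurd h h0.ne', hdj⟩
  have hzero : ∀ s ∈ Set.Ico t b, T.coord j (γ s) = 0 := fun s hs => by
    have hs' : s ∈ Set.Ico a b := ⟨ht.1.trans hs.1, hs.2⟩
    refine le_antisymm ?_ (hbody s hs' j)
    rw [← hj]
    exact le_of_hasDerivWithinAt_right_nonneg (f := fun s => T.coord j (γ s)) hs.2.le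
      ((T.continuous_coord j).comp_continuousOn (hγ.1.mono (Set.Icc_subset_Icc_left hs'.1)))
      fun r hr => by
        obtain ⟨d, h1, -, h2⟩ := hderiv r ⟨hs'.1.trans hr.1, hr.2⟩
        exact ⟨d, h1, h2⟩
  obtain ⟨d, -, hd, hder⟩ := hderiv t ht
  have hder0 : HasDerivWithinAt (fun s => T.coord j (γ s)) 0 (Set.Ici t) t := by
    refine (hasDerivWithinAt_const t (Set.Ici t) (0 : ℝ)).congr_of_eventuallyEq ?_
      (hzero t ⟨le_rfl, ht.2⟩)
    filter_upwards [Ico_mem_nhdsGE ht.2] with s hs using hzero s hs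
  have := (uniqueDiffWithinAt_Ici t).eq_deriv _ hder hder0
  exact (hd hi.symm).ne' this

/-- A curve that starts at the foot of face `l`, avoids the vertices and arrives at `γ t₂` from
the interior of face `i` follows a backward path. -/
lemma IsCurveFrom.exists_backPath (ho : o ∈ interior T.body) {x : E3} {I : Set ℝ} {γ : ℝ → E3}
    (hγ : T.IsCurveFrom o x I γ) {l : Fin 4} (hx : x = T.foot o l) (hl : T.OnFace l x)
    (hvert : ∀ t ∈ I, ∀ m, γ t ≠ T.points m) (i : Fin 4) : ∀ t₂ ∈ I,
      (∃ t₁ ∈ I, t₁ < t₂ ∧ ∀ t ∈ Set.Ico t₁ t₂, T.OnFace i (γ t)) →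
      ∃ N, T.BackPath o i (γ t₂) N l ∧ γ '' (I ∩ Set.Iic t₂) = N := by
  induction i using (wellFounded_leads (T.polar o)).induction with
  | _ i ih =>
  rintro t₂ ht₂ ⟨t₁, ht₁, ht₁₂, hface⟩
  set p := T.foot o i with hp
  set q := γ t₂ with hq
  have hI : ∀ {a b t}, a ∈ I → b ∈ I → t ∈ Set.Icc a b → t ∈ I := fun ha hb ht =>
    hγ.ordConnected.out ha hb ht
  -- the curve does not return to the foot of the face
  have hqp : q ≠ p := by
    obtain ⟨h1, h2, -⟩ := (hγ.isAscendingOn ht₁ ht₂).eq_rayPoint ho ht₁₂ hface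
    exact sub_ne_zero.1 (norm_pos_iff.1 (h2.trans_le h1))
  have hqp' : 0 < ‖q - p‖ := norm_pos_iff.2 (sub_ne_zero.2 hqp)
  -- the parameter on the ray
  set ρ : ℝ → ℝ := fun t => ‖γ t - p‖ / ‖q - p‖ with hρ
  have hρ₂ : ρ t₂ = 1 := div_self hqp'.ne'
  have hρc : ∀ {a}, a ∈ I → ContinuousOn ρ (Set.Icc a t₂) := fun ha =>
    ((hγ.continuousOn.mono (hγ.ordConnected.out ha ht₂)).sub continuousOn_const).norm.div_const _
  have hray : ∀ t ∈ I, t ≤ t₂ → (∀ s ∈ Set.Ico t t₂, T.OnFace i (γ s)) →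
      ρ t ≤ 1 ∧ 0 < ρ t ∧ γ t = T.rayPoint o i q (ρ t) := by
    intro t ht htle hs
    rcases htle.eq_or_lt with rfl | htlt
    · rw [hρ₂, rayPoint, one_smul]
      exact ⟨le_rfl, one_pos, by abel⟩
    obtain ⟨h1, h2, h3⟩ := (hγ.isAscendingOn ht ht₂).eq_rayPoint ho htlt hs
    exact ⟨(div_le_one hqp').2 h1, div_pos h2 hqp', h3⟩
  have hρmono : ∀ t ∈ I, ∀ s ∈ I, t ≤ s → s ≤ t₂ → (∀ r ∈ Set.Ico t t₂, T.OnFace i (γ r)) →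
      ρ t ≤ ρ s := by
    intro t ht s hs hts hst hr
    rcases hts.eq_or_lt with rfl | hts
    · exact le_rfl
    exact div_le_div_of_nonneg_right ((hγ.isAscendingOn ht hs).eq_rayPoint ho hts fun r hr' =>
      hr r ⟨hr'.1, hr'.2.trans_le hst⟩).1 hqp'.le
  by_cases hall : ∀ t ∈ I, t < t₂ → T.OnFace i (γ t)
  · -- the curve stays in face `i` all the way down to its origin
    have hxi : T.coord i x = 0 := by
      by_contra hne
      obtain ⟨t₀, ht₀, h⟩ := hγ.eventually
        ((T.continuous_coord i).continuousAt.eventually_ne hne)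
      rcases le_total t₀ t₁ with hle | hle
      · exact h t₀ ht₀ le_rfl (hall t₀ ht₀ (hle.trans_lt ht₁₂)).1
      · exact h t₁ ht₁ hle (hall t₁ ht₁ ht₁₂).1
    have hil : i = l := by
      by_contra hne
      exact (hl.2 i hne).ne' hxi
    subst hil
    have hsub : ∀ t ∈ I, ∀ s ∈ Set.Ico t t₂, T.OnFace i (γ s) := fun t ht s hs =>
      hall s (hI ht ht₂ ⟨hs.1, hs.2.le⟩) hs.2
    have hsurj : ∀ r : ℝ, 0 < r → r ≤ 1 → ∃ t ∈ I, t ≤ t₂ ∧ ρ t = r := by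
      intro r hr0 hr1
      obtain ⟨t₀, ht₀, h⟩ := hγ.tendsto (r * ‖q - p‖) (by positivity)
      obtain ⟨t', ht', htt₀, htt₂⟩ : ∃ t' ∈ I, t' ≤ t₀ ∧ t' ≤ t₂ := by
        rcases le_total t₀ t₂ with hle | hle
        exacts [⟨t₀, ht₀, le_rfl, hle⟩, ⟨t₂, ht₂, hle, le_rfl⟩]
      have hρt' : ρ t' ≤ r := by
        have := h t' ht' htt₀
        rw [hx, dist_eq_norm] at this
        exact (div_le_iff₀ hqp').2 this.le
      obtain ⟨t, ht, hrt⟩ := intermediate_value_Icc htt₂ (hρc ht')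
        (show r ∈ Set.Icc (ρ t') (ρ t₂) from ⟨hρt', by rw [hρ₂]; exact hr1⟩)
      exact ⟨t, hI ht' ht₂ ht, ht.2, hrt⟩
    refine ⟨_, BackPath.last i q fun r hr0 hr1 => ?_, ?_⟩
    · obtain ⟨t, ht, htle, rfl⟩ := hsurj r hr0 hr1.le
      rw [← (hray t ht htle (hsub t ht)).2.2]
      refine hall t ht (lt_of_le_of_ne htle ?_)
      rintro rfl
      rw [hρ₂] at hr1
      exact lt_irrefl _ hr1
    · ext z
      constructor
      · rintro ⟨t, ⟨ht, htle⟩, rfl⟩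
        obtain ⟨h1, h2, h3⟩ := hray t ht htle (hsub t ht)
        exact ⟨ρ t, ⟨h2, h1⟩, h3.symm⟩
      · rintro ⟨r, ⟨hr0, hr1⟩, rfl⟩
        obtain ⟨t, ht, htle, rfl⟩ := hsurj r hr0 hr1
        exact ⟨t, ⟨ht, htle⟩, (hray t ht htle (hsub t ht)).2.2⟩
  · push Not at hall
    obtain ⟨t₃, ht₃, ht₃₂, hbad⟩ := hall
    have hpos_of : ∀ t ∈ I, t < t₂ → (∀ k ≠ i, 0 < T.coord k (γ t)) → T.OnFace i (γ t) := by
      intro t ht htlt h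
      obtain ⟨v, hv, -⟩ := hγ.deriv t ht (htlt.trans_le (hγ.nonpos t₂ ht₂))
      obtain ⟨-, m, hm⟩ := hv.2.1.exists_coord_eq_zero
      by_cases hmi : m = i
      · exact ⟨hmi ▸ hm, h⟩
      · exact absurd hm (h m hmi).ne'
    have h31 : t₃ < t₁ := by
      by_contra! hle
      exact hbad (hface t₃ ⟨hle, ht₃₂⟩)
    have hccont : ∀ k, ContinuousOn (fun t => T.coord k (γ t)) (Set.Icc t₃ t₂) := fun k =>
      (T.continuous_coord k).comp_continuousOn
        (hγ.continuousOn.mono (hγ.ordConnected.out ht₃ ht₂))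
    -- the last time `τ` before `t₂` at which the curve is not in the interior of face `i`
    obtain ⟨τ, hτK, hτmax⟩ : ∃ τ, IsGreatest
        (⋃ k ∈ {k | k ≠ i}, Set.Icc t₃ t₁ ∩ (fun t => T.coord k (γ t)) ⁻¹' Set.Iic 0) τ := by
      refine IsCompact.exists_isGreatest (isCompact_Icc.of_isClosed_subset ?_
        (Set.iUnion₂_subset fun k _ => Set.inter_subset_left)) ?_
      · exact (Set.toFinite _).isClosed_biUnion fun k _ =>
          ((hccont k).mono (Set.Icc_subset_Icc_right ht₁₂.le)).preimage_isClosed_of_isClosed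
            isClosed_Icc isClosed_Iic
      · have : ∃ k ≠ i, T.coord k (γ t₃) ≤ 0 := by
          by_contra! h
          exact hbad (hpos_of t₃ ht₃ ht₃₂ h)
        obtain ⟨k, hk, hk0⟩ := this
        exact ⟨t₃, Set.mem_biUnion hk ⟨⟨le_rfl, h31.le⟩, hk0⟩⟩
    simp only [Set.mem_iUnion] at hτK
    obtain ⟨j, hji, hτ31, hjτ⟩ := hτK
    have hji : j ≠ i := hji
    have hjτ : T.coord j (γ τ) ≤ 0 := hjτ
    have hτI : τ ∈ I := hI ht₃ ht₁ hτ31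
    have hτ₂ : τ < t₂ := hτ31.2.trans_lt ht₁₂
    have hτneg : τ < 0 := hτ₂.trans_le (hγ.nonpos t₂ ht₂)
    obtain ⟨vτ, hvτ, -⟩ := hγ.deriv τ hτI hτneg
    have hτb : ∀ k, 0 ≤ T.coord k (γ τ) := T.mem_body_iff.1 hvτ.2.1.exists_coord_eq_zero.1
    have hj0 : T.coord j (γ τ) = 0 := le_antisymm hjτ (hτb j)
    have hafter : ∀ t, τ < t → t < t₂ → T.OnFace i (γ t) := by
      intro t h1 h2
      rcases le_total t₁ t with hle | hle
      · exact hface t ⟨hle, h2⟩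
      · refine hpos_of t (hI hτI ht₁ ⟨h1.le, hle⟩) h2 fun k hk => ?_
        by_contra! hk0
        exact not_lt.2 (hτmax (Set.mem_biUnion (show k ∈ {k | k ≠ i} from hk)
          ⟨⟨hτ31.1.trans h1.le, hle⟩, hk0⟩)) h1
    have hmemI : ∀ t ∈ Set.Icc τ t₂, t ∈ I := fun t ht => hI hτI ht₂ ht
    have hcl : closure (Set.Ioo τ t₂) = Set.Icc τ t₂ := closure_Ioo hτ₂.ne
    have hγc : ContinuousOn γ (Set.Icc τ t₂) := hγ.continuousOn.mono hmemI
    have hi0 : T.coord i (γ τ) = 0 := by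
      refine Set.EqOn.of_subset_closure (s := Set.Ioo τ t₂) (t := Set.Icc τ t₂)
        (f := fun t => T.coord i (γ t)) (g := fun _ => 0) (fun t ht => (hafter t ht.1 ht.2).1)
        ((T.continuous_coord i).comp_continuousOn hγc) continuousOn_const
        Set.Ioo_subset_Icc_self hcl.ge (Set.left_mem_Icc.2 hτ₂.le)
    have hrayτ : ∀ t ∈ Set.Icc τ t₂, γ t = T.rayPoint o i q (ρ t) := by
      refine Set.EqOn.of_subset_closure (s := Set.Ioo τ t₂) (fun t ht => ?_) hγc ?_
        Set.Ioo_subset_Icc_self hcl.ge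
      · exact (hray t (hmemI t ⟨ht.1.le, ht.2.le⟩) ht.2.le fun s hs =>
          hafter s (ht.1.trans_le hs.1) hs.2).2.2
      · exact continuousOn_const.add ((hρc hτI).smul continuousOn_const)
    have hτp : γ τ ≠ p := by
      intro h
      refine (isEquilibrium_foot ho (i := i) ?_).not_isExtendedGradient (v := vτ) ?_
      · rw [← hp, ← h]; exact T.mem_body_iff.2 hτb
      · rw [← hp, ← h]; exact hvτ
    have hρ0 : 0 < ρ τ := div_pos (norm_pos_iff.2 (sub_ne_zero.2 hτp)) hqp'
    have hcoordj : ∀ t ∈ Set.Icc τ t₂, T.coord j (γ t) =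
        T.coord j p + ρ t * (T.coord j q - T.coord j p) := fun t ht => by
      conv_lhs => rw [hrayτ t ht, coord_rayPoint]
    have hcj := hcoordj τ ⟨le_rfl, hτ₂.le⟩
    rw [hj0] at hcj
    have hρlt : ∀ t ∈ Set.Ioo τ t₂, ρ τ < ρ t := by
      intro t ht
      have hle : ρ τ ≤ ρ t := by
        have hcl' : closure (Set.Ioo τ t) = Set.Icc τ t := closure_Ioo ht.1.ne
        have htI := hmemI t ⟨ht.1.le, ht.2.le⟩
        refine le_on_closure (s := Set.Ioo τ t) (f := ρ) (g := fun _ => ρ t) (fun s hs => ?_) ?_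
          continuousOn_const (by rw [hcl']; exact Set.left_mem_Icc.2 ht.1.le)
        · exact hρmono s (hmemI s ⟨hs.1.le, (hs.2.trans ht.2).le⟩) t htI hs.2.le ht.2.le
            fun r hr => hafter r (hs.1.trans_le hr.1) hr.2
        · rw [hcl']; exact (hρc hτI).mono (Set.Icc_subset_Icc_right ht.2.le)
      refine lt_of_le_of_ne hle fun heq => ?_
      have h1 := hcoordj t ⟨ht.1.le, ht.2.le⟩
      rw [← heq, ← hcj] at h1
      exact ((hafter t ht.1 ht.2).2 j hji).ne' h1
    obtain ⟨t₄, ht₄⟩ : ∃ t₄, t₄ ∈ Set.Ioo τ t₂ := Set.nonempty_Ioo.2 hτ₂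
    have hρle : ∀ t ∈ Set.Ioc τ t₂, ρ τ < ρ t ∧ ρ t ≤ 1 := by
      intro t ht
      rcases ht.2.eq_or_lt with rfl | hlt
      · rw [hρ₂]
        exact ⟨(hρlt t₄ ht₄).trans_le (hray t₄ (hmemI t₄ ⟨ht₄.1.le, ht₄.2.le⟩) ht₄.2.le
          fun s hs => hafter s (ht₄.1.trans_le hs.1) hs.2).1, le_rfl⟩
      · exact ⟨hρlt t ⟨ht.1, hlt⟩, (hray t (hmemI t ⟨ht.1.le, ht.2⟩) ht.2
          fun s hs => hafter s (ht.1.trans_le hs.1) hs.2).1⟩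
    have hρ1 : ρ τ < 1 := hρ₂ ▸ (hρle t₂ ⟨hτ₂, le_rfl⟩).1
    have hfoot : T.coord j p < 0 := by
      have h1 := hcoordj t₄ ⟨ht₄.1.le, ht₄.2.le⟩
      have h2 := (hafter t₄ ht₄.1 ht₄.2).2 j hji
      have h3 := hρlt t₄ ht₄
      have hΔ : 0 < T.coord j q - T.coord j p := by
        by_contra! hneg
        nlinarith
      nlinarith [mul_pos hρ0 hΔ]
    have hleads : Leads (T.polar o) i j := (coord_foot_neg_iff ho i j).1 hfoot
    have hother : ∀ k, k ≠ i → k ≠ j → 0 < T.coord k (γ τ) := by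
      intro k hki hkj
      refine lt_of_le_of_ne (hτb k) fun hk0 => ?_
      obtain ⟨m, hmi, hmj, hmk⟩ := (by decide : ∀ i j k : Fin 4, ∃ l, l ≠ i ∧ l ≠ j ∧ l ≠ k) i j k
      have h0 : ∀ n ≠ m, T.coord n (γ τ) = 0 := fun n hn => by
        have : n = i ∨ n = j ∨ n = k := by omega
        rcases this with rfl | rfl | rfl
        exacts [hi0, hj0, hk0.symm]
      have h1 : T.coord m (γ τ) = 1 := by
        rw [← T.sum_coord (γ τ)]
        exact (Finset.sum_eq_single m (fun n _ hn => h0 n hn) (by simp)).symm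
      refine hvert τ hτI m (T.eq_of_coord_eq fun n => ?_)
      by_cases hn : n = m
      · rw [hn, h1, coord_point_self]
      · rw [h0 n hn, T.coord_point_of_ne hn]
    -- before `τ` the curve runs in face `j`
    obtain ⟨t₅, ht₅, h₅τ, hj₅⟩ : ∃ t₅ ∈ I, t₅ < τ ∧ ∀ t ∈ Set.Ico t₅ τ, T.OnFace j (γ t) := by
      obtain ⟨a, ha, haτ⟩ := hγ.exists_lt τ hτI
      have hev : ∀ᶠ t in nhdsWithin τ (Set.Iic τ), ∀ k, k ≠ i → k ≠ j → 0 < T.coord k (γ t) := by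
        rw [← nhdsWithin_Icc_eq_nhdsLE haτ, Filter.eventually_all]
        intro k
        rw [Filter.eventually_imp_distrib_left]
        intro hki
        rw [Filter.eventually_imp_distrib_left]
        intro hkj
        exact ((T.continuous_coord k).comp_continuousOn (hγ.continuousOn.mono
          (hγ.ordConnected.out ha hτI))).continuousWithinAt (Set.right_mem_Icc.2 haτ.le)
          |>.eventually (lt_mem_nhds (hother k hki hkj))
      obtain ⟨b, hb, hbs⟩ := mem_nhdsLE_iff_exists_Icc_subset.1 hev
      have hbI : max a b ∈ I := hI ha hτI ⟨le_max_left _ _, max_le haτ.le (le_of_lt hb)⟩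
      refine ⟨max a b, hbI, max_lt haτ hb, ?_⟩
      exact (hγ.isAscendingOn hbI hτI).onFace_of_crossing ho hj0 hfoot fun t ht =>
        hbs ⟨(le_max_right a b).trans ht.1, ht.2⟩
    obtain ⟨N, hN, hNim⟩ := ih j hleads τ hτI ⟨t₅, ht₅, h₅τ, hj₅⟩
    have hqτ := hrayτ τ ⟨le_rfl, hτ₂.le⟩
    have hsurj : ∀ r, ρ τ < r → r ≤ 1 → ∃ t ∈ Set.Ioc τ t₂, ρ t = r := by
      intro r hr0 hr1
      obtain ⟨t, ht, hrt⟩ := intermediate_value_Icc hτ₂.le (hρc hτI)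
        (show r ∈ Set.Icc (ρ τ) (ρ t₂) from ⟨hr0.le, by rw [hρ₂]; exact hr1⟩)
      refine ⟨t, ⟨lt_of_le_of_ne ht.1 ?_, ht.2⟩, hrt⟩
      rintro rfl
      exact hr0.ne hrt
    refine ⟨_, BackPath.step i j l q N (ρ τ) hρ0 hρ1 (fun r hr0 hr1 => ?_) hleads
      (hqτ ▸ hj0) (fun k hki hkj => hqτ ▸ hother k hki hkj) (hqτ ▸ hN), ?_⟩
    · obtain ⟨t, ht, rfl⟩ := hsurj r hr0 hr1.le
      rw [← hrayτ t ⟨ht.1.le, ht.2⟩]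
      refine hafter t ht.1 (lt_of_le_of_ne ht.2 ?_)
      rintro rfl
      rw [hρ₂] at hr1
      exact lt_irrefl _ hr1
    · rw [← hNim]
      ext z
      constructor
      · rintro ⟨t, ⟨ht, htle⟩, rfl⟩
        rcases le_or_gt t τ with hle | hlt
        · exact Or.inr ⟨t, ⟨ht, hle⟩, rfl⟩
        · exact Or.inl ⟨ρ t, hρle t ⟨hlt, htle⟩, (hrayτ t ⟨hlt.le, htle⟩).symm⟩
      · rintro (⟨r, ⟨hr0, hr1⟩, rfl⟩ | ⟨t, ⟨ht, htle⟩, rfl⟩)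
        · obtain ⟨t, ht, rfl⟩ := hsurj r hr0 hr1
          exact ⟨t, ⟨hmemI t ⟨ht.1.le, ht.2⟩, ht.2⟩, hrayτ t ⟨ht.1.le, ht.2⟩⟩
        · exact ⟨t, ⟨ht, (Set.mem_Iic.1 htle).trans hτ₂.le⟩, rfl⟩

/-! ### Saddles -/

/-- `h` is a saddle in the relative interior of the edge with vertices `a` and `b`. -/
structure IsSaddleEdge (T : Tetrahedron) (o h : E3) (a b : Fin 4) : Prop where
  ne : a ≠ b
  isEquilibrium : T.IsEquilibrium o h
  pos_left : 0 < T.coord a h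
  pos_right : 0 < T.coord b h
  coord_eq_zero : ∀ i, i ≠ a → i ≠ b → T.coord i h = 0
  inner_left : inner ℝ (h - o) (T.points a - h) = 0
  inner_right : inner ℝ (h - o) (T.points b - h) = 0
  inner_neg : ∀ i, i ≠ a → i ≠ b → inner ℝ (h - o) (T.points i - h) < 0

lemma IsSaddle.exists_edge {h : E3} (hh : T.IsSaddle o h) : ∃ a b, T.IsSaddleEdge o h a b := by
  obtain ⟨s, hs, heq, hopen, hcontact⟩ := hh
  obtain ⟨a, b, hab, rfl⟩ := Finset.card_eq_two.1 hs
  obtain ⟨hpos, hzero⟩ := T.mem_openFace_iff.1 hopen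
  have hperp : ∀ i ∈ ({a, b} : Finset (Fin 4)), inner ℝ (h - o) (T.points i - h) = 0 := by
    intro i hi
    have : T.points i ∈ T.contactSet o h := by rw [hcontact]; exact T.point_mem_closedFace hi
    rw [real_inner_comm]; exact this.2
  refine ⟨a, b, hab, heq, hpos a (by simp), hpos b (by simp), fun i h1 h2 => hzero i (by simp [h1, h2]),
    hperp a (by simp), hperp b (by simp), fun i h1 h2 => ?_⟩
  refine lt_of_le_of_ne ?_ fun h0 => ?_
  · rw [real_inner_comm]; exact heq.2.2 _ (T.point_mem_body i)
  · have : T.points i ∈ T.contactSet o h :=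
      ⟨T.point_mem_body i, by rw [real_inner_comm]; exact h0⟩
    rw [hcontact] at this
    have := (T.mem_closedFace_iff.1 this).2 i (by simp [h1, h2])
    rw [coord_point_self] at this
    exact one_ne_zero this

lemma IsUnstable.exists_vertex {u : E3} (hu : T.IsUnstable o u) :
    ∃ m, u = T.points m ∧ ∀ j, ¬ Leads (fun m => T.points m - o) m j := by
  obtain ⟨s, hs, heq, hopen, -⟩ := hu
  obtain ⟨m, rfl⟩ := Finset.card_eq_one.1 hs
  obtain ⟨-, hzero⟩ := T.mem_openFace_iff.1 hopen
  have hum : u = T.points m := by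
    have h0 : ∀ n ≠ m, T.coord n u = 0 := fun n hn => hzero n (by simp [hn])
    have h1 : T.coord m u = 1 := by
      rw [← T.sum_coord u]
      exact (Finset.sum_eq_single m (fun n _ hn => h0 n hn) (by simp)).symm
    refine T.eq_of_coord_eq fun n => ?_
    by_cases hn : n = m
    · rw [hn, h1, coord_point_self]
    · rw [h0 n hn, T.coord_point_of_ne hn]
  refine ⟨m, hum, fun j hj => ?_⟩
  have h1 := heq.2.2 _ (T.point_mem_body j)
  rw [leads_points_iff, ← hum, real_inner_comm] at hj
  linarith

namespace IsSaddleEdge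

variable {h : E3} {a b : Fin 4}

lemma symm (H : T.IsSaddleEdge o h a b) : T.IsSaddleEdge o h b a :=
  ⟨H.ne.symm, H.isEquilibrium, H.pos_right, H.pos_left, fun i h1 h2 => H.coord_eq_zero i h2 h1,
    H.inner_right, H.inner_left, fun i h1 h2 => H.inner_neg i h2 h1⟩

lemma inner_edge (H : T.IsSaddleEdge o h a b) :
    inner ℝ (h - o) (T.points a - T.points b) = 0 := by
  rw [show T.points a - T.points b = (T.points a - h) - (T.points b - h) by abel, inner_sub_right,
    H.inner_left, H.inner_right, sub_zero]

/-- Points of the edge line in terms of the coordinate of `a`. -/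
lemma eq_add_smul (H : T.IsSaddleEdge o h a b) {x : E3}
    (hx : ∀ i, i ≠ a → i ≠ b → T.coord i x = 0) :
    x = h + (T.coord a x - T.coord a h) • (T.points a - T.points b) := by
  have hb : ∀ y, (∀ i, i ≠ a → i ≠ b → T.coord i y = 0) → T.coord b y = 1 - T.coord a y := by
    intro y hy
    have h1 := T.sum_coord y
    rw [← Finset.sum_subset (Finset.subset_univ {a, b}) fun i _ hi => by
      simp only [Finset.mem_insert, Finset.mem_singleton, not_or] at hi
      exact hy i hi.1 hi.2, Finset.sum_pair H.ne] at h1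
    linarith
  refine T.eq_of_coord_eq fun i => ?_
  rw [coord_add, inner_smul_right, inner_coordGrad_sub]
  by_cases hia : i = a
  · rw [hia, coord_point_self, T.coord_point_of_ne H.ne]; ring
  by_cases hib : i = b
  · rw [hib, coord_point_self, T.coord_point_of_ne H.ne.symm, hb x hx, hb h H.coord_eq_zero]; ring
  · rw [hx i hia hib, H.coord_eq_zero i hia hib, T.coord_point_of_ne hia, T.coord_point_of_ne hib]
    ring

/-- If both ends of the edge of a saddle are connected to the same vertex by chains along which
the distance grows, then every other vertex is the starting point of a growing edge. -/
lemma exists_leads_vertices (H : T.IsSaddleEdge o h a b) {m : Fin 4}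
    (ha : Relation.ReflTransGen (Leads fun m => T.points m - o) a m)
    (hb : Relation.ReflTransGen (Leads fun m => T.points m - o) b m) :
    ∀ l ≠ m, ∃ j, Leads (fun m => T.points m - o) l j := by
  have hbh := H.symm.eq_add_smul (x := T.points b) fun i h1 h2 => T.coord_point_of_ne h1
  have hah := H.eq_add_smul (x := T.points a) fun i h1 h2 => T.coord_point_of_ne h1
  rw [coord_point_self] at hbh hah
  have hsum : T.coord b h = 1 - T.coord a h := by
    have h1 := T.sum_coord h
    rw [← Finset.sum_subset (Finset.subset_univ {a, b}) fun i _ hi => by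
      simp only [Finset.mem_insert, Finset.mem_singleton, not_or] at hi
      exact H.coord_eq_zero i hi.1 hi.2, Finset.sum_pair H.ne] at h1
    linarith
  refine exists_leads_of_chains (k := h - o) H.ne H.pos_right H.pos_left ?_ ?_ ?_ ?_ ha hb
  · rw [sub_sub_sub_cancel_right, hsum]
    nth_rewrite 1 [hah]
    abel
  · rw [sub_sub_sub_cancel_right, ← neg_sub (T.points b), smul_neg, sub_neg_eq_add,
      show T.coord a h = 1 - T.coord b h by linarith]
    nth_rewrite 1 [hbh]
    abel
  · rw [sub_sub_sub_cancel_right, H.inner_edge]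
  · intro l h1 h2
    have := H.inner_neg l h1 h2
    rw [show T.points l - o = (T.points l - h) + (h - o) by abel, inner_add_left,
      real_inner_self_eq_norm_sq, real_inner_comm]
    linarith

/-- The radial vector of a saddle, inverted in the unit sphere about `o`, is the point of the
dual edge that is closest to `o`. -/
lemma polar_edge (H : T.IsSaddleEdge o h a b) (ho : o ∈ interior T.body) {c d : Fin 4}
    (hca : c ≠ a) (hcb : c ≠ b) (hda : d ≠ a) (hdb : d ≠ b) (hcd : c ≠ d) :
    ∃ (k : E3) (s t : ℝ), 0 < s ∧ 0 < t ∧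
      T.polar o c = k + s • (T.polar o c - T.polar o d) ∧
      T.polar o d = k - t • (T.polar o c - T.polar o d) ∧
      inner ℝ k (T.polar o c - T.polar o d) = 0 ∧
      ∀ l, l ≠ c → l ≠ d → inner ℝ (T.polar o l) k < ‖k‖ ^ 2 := by
  have hho : 0 < ‖h - o‖ ^ 2 := by
    have := norm_pos_iff.2 (sub_ne_zero.2 H.isEquilibrium.2.1)
    positivity
  have huniv : (Finset.univ : Finset (Fin 4)) = {a, b, c, d} := by
    ext m
    have hab := H.ne
    have : m = a ∨ m = b ∨ m = c ∨ m = d := by omega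
    simpa using this
  set A := -(inner ℝ (h - o) (T.points c - h)) * T.coord c o with hA
  set B := -(inner ℝ (h - o) (T.points d - h)) * T.coord d o with hB
  have hA0 : 0 < A := mul_pos (by linarith [H.inner_neg c hca hcb]) (T.coord_pos_of_mem_interior ho c)
  have hB0 : 0 < B := mul_pos (by linarith [H.inner_neg d hda hdb]) (T.coord_pos_of_mem_interior ho d)
  have hκ : h - o = A • T.polar o c + B • T.polar o d := by
    conv_lhs => rw [← T.sum_inner_smul_coordGrad (h - o) h]
    rw [huniv, Finset.sum_insert (by simp [H.ne, hca.symm, hda.symm]),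
      Finset.sum_insert (by simp [hcb.symm, hdb.symm]), Finset.sum_pair hcd, H.inner_left,
      H.inner_right, coordGrad_eq_polar ho c, coordGrad_eq_polar ho d, hA, hB]
    module
  have hone : ∀ i, T.coord i h = 0 → inner ℝ (T.polar o i) (h - o) = 1 := by
    intro i hi
    have h1 := coord_eq_polar ho i h
    rw [hi, eq_comm, mul_eq_zero, or_iff_right (T.coord_pos_of_mem_interior ho i).ne'] at h1
    linarith
  have hc1 := hone c (H.coord_eq_zero c hca hcb)
  have hd1 := hone d (H.coord_eq_zero d hda hdb)
  have hn : ‖h - o‖ ^ 2 = A + B := by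
    have h1 : inner ℝ (h - o) (h - o) = A + B := by
      nth_rewrite 1 [hκ]
      rw [inner_add_left, inner_smul_left, inner_smul_left, hc1, hd1]; simp
    rwa [real_inner_self_eq_norm_sq] at h1
  have hAB : A + B ≠ 0 := by positivity
  refine ⟨(A + B)⁻¹ • (h - o), B / (A + B), A / (A + B), by positivity, by positivity, ?_, ?_, ?_,
    fun l hlc hld => ?_⟩
  · have h1 : B / (A + B) = 1 - (A + B)⁻¹ * A := by field_simp; ring
    have h2 : (A + B)⁻¹ * B = 1 - (A + B)⁻¹ * A := by field_simp; ring
    rw [hκ, h1, smul_add, smul_smul, smul_smul, h2]; module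
  · have h1 : A / (A + B) = (A + B)⁻¹ * A := by field_simp
    have h2 : (A + B)⁻¹ * B = 1 - (A + B)⁻¹ * A := by field_simp; ring
    rw [hκ, h1, smul_add, smul_smul, smul_smul, h2]; module
  · rw [inner_smul_left, inner_sub_right, real_inner_comm, hc1, real_inner_comm, hd1]; simp
  · have hlab : l = a ∨ l = b := by
      have hab := H.ne
      omega
    have hl0 : 0 < T.coord l h := by
      rcases hlab with rfl | rfl
      exacts [H.pos_left, H.pos_right]
    have h1 : inner ℝ (T.polar o l) (h - o) < 1 := by
      rw [coord_eq_polar ho l h] at hl0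
      have := pos_of_mul_pos_right hl0 (T.coord_pos_of_mem_interior ho l).le
      linarith
    rw [inner_smul_right, norm_smul, mul_pow, hn, Real.norm_of_nonneg (by positivity)]
    have h2 : 0 < (A + B)⁻¹ := by positivity
    rw [show (A + B)⁻¹ ^ 2 * (A + B) = (A + B)⁻¹ * 1 by field_simp]
    exact mul_lt_mul_of_pos_left h1 h2

lemma coord_foot_pos (H : T.IsSaddleEdge o h a b) (ho : o ∈ interior T.body) {c d : Fin 4}
    (hca : c ≠ a) (hcb : c ≠ b) (hda : d ≠ a) (hdb : d ≠ b) (hcd : c ≠ d) :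
    0 < T.coord d (T.foot o c) := by
  obtain ⟨k, s, t, hs, -, h1, -, h3, -⟩ := H.polar_edge ho hca hcb hda hdb hcd
  set e := T.polar o c - T.polar o d with he
  have he0 : e ≠ 0 := by
    intro h0
    have heq : T.polar o c = T.polar o d := sub_eq_zero.1 h0
    have h1 := coord_eq_polar ho c (T.points d)
    have h2 := coord_eq_polar ho d (T.points d)
    rw [T.coord_point_of_ne hcd, eq_comm, mul_eq_zero,
      or_iff_right (T.coord_pos_of_mem_interior ho c).ne', heq] at h1
    rw [h1, mul_zero, coord_point_self] at h2
    exact one_ne_zero h2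
  rw [coord_foot_pos_iff ho, ← sub_pos, ← real_inner_self_eq_norm_sq, ← inner_sub_left, ← he]
  nth_rewrite 1 [h1]
  rw [inner_add_right, real_inner_comm, h3, inner_smul_right, real_inner_self_eq_norm_sq, zero_add]
  have := norm_pos_iff.2 he0
  positivity

/-! ### Curves that leave or reach a saddle -/

/-- A curve that starts at a saddle runs inside its edge for some time: in both adjacent faces
the flow close to the saddle is directed towards the edge, so the sum of the two coordinates that
vanish on the edge cannot grow from its limit `0`. -/
lemma exists_start (H : T.IsSaddleEdge o h a b) (ho : o ∈ interior T.body) {I : Set ℝ}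
    {γ : ℝ → E3} (hγ : T.IsCurveFrom o h I γ) :
    ∃ t₀ ∈ I, t₀ < 0 ∧ ∀ t ∈ I, t ≤ t₀ → 0 < T.coord a (γ t) ∧ 0 < T.coord b (γ t) ∧
      ∀ i, i ≠ a → i ≠ b → T.coord i (γ t) = 0 := by
  obtain ⟨c, d, hca, hcb, hda, hdb, hcd⟩ : ∃ c d, c ≠ a ∧ c ≠ b ∧ d ≠ a ∧ d ≠ b ∧ c ≠ d :=
    (by decide : ∀ a b : Fin 4, a ≠ b → ∃ c d, c ≠ a ∧ c ≠ b ∧ d ≠ a ∧ d ≠ b ∧ c ≠ d) a b H.ne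
  have hlast : ∀ m, m = a ∨ m = b ∨ m = c ∨ m = d := by have := H.ne; omega
  have hcd0 := H.coord_foot_pos ho hca hcb hda hdb hcd
  have hdc0 := H.coord_foot_pos ho hda hdb hca hcb hcd.symm
  have hev : ∀ᶠ y in nhds h, 0 < T.coord a y ∧ 0 < T.coord b y ∧
      T.coord d y < T.coord d (T.foot o c) ∧ T.coord c y < T.coord c (T.foot o d) := by
    refine ((T.continuous_coord a).continuousAt.eventually (lt_mem_nhds H.pos_left)).and
      (((T.continuous_coord b).continuousAt.eventually (lt_mem_nhds H.pos_right)).and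
      (((T.continuous_coord d).continuousAt.eventually (gt_mem_nhds ?_)).and
      ((T.continuous_coord c).continuousAt.eventually (gt_mem_nhds ?_))))
    · rwa [H.coord_eq_zero d hda hdb]
    · rwa [H.coord_eq_zero c hca hcb]
  obtain ⟨t₁, ht₁, hnear⟩ := hγ.eventually hev
  obtain ⟨t₀, ht₀, ht₀₁⟩ := hγ.exists_lt t₁ ht₁
  have ht₀neg : t₀ < 0 := ht₀₁.trans_le (hγ.nonpos t₁ ht₁)
  refine ⟨t₀, ht₀, ht₀neg, fun t ht htle => ?_⟩
  have hbody : ∀ s ∈ I, s ≤ t₀ → ∀ k, 0 ≤ T.coord k (γ s) := fun s hs hle => by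
    obtain ⟨v, hv, -⟩ := hγ.deriv s hs (hle.trans_lt ht₀neg)
    exact T.mem_body_iff.1 hv.2.1.exists_coord_eq_zero.1
  -- the sum of the two coordinates that vanish on the edge does not increase
  have hψ : ∀ s ∈ I, s ≤ t →
      T.coord c (γ t) + T.coord d (γ t) ≤ T.coord c (γ s) + T.coord d (γ s) := by
    intro s hs hst
    rw [← neg_le_neg_iff]
    refine le_of_hasDerivWithinAt_right_nonneg (f := fun t => -(T.coord c (γ t) + T.coord d (γ t)))
      hst ?_ fun r hr => ?_
    · have hc := hγ.continuousOn.mono (hγ.ordConnected.out hs ht)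
      exact (((T.continuous_coord c).comp_continuousOn hc).add
        ((T.continuous_coord d).comp_continuousOn hc)).neg
    · have hrI : r ∈ I := hγ.ordConnected.out hs ht ⟨hr.1, hr.2.le⟩
      have hr0 : r ≤ t₀ := hr.2.le.trans htle
      obtain ⟨v, hv, hd⟩ := hγ.deriv r hrI (hr0.trans_lt ht₀neg)
      obtain ⟨hna, hnb, hnd, hnc⟩ := hnear r hrI (hr0.trans ht₀₁.le)
      have hrad : 0 < ‖γ r - o‖ := norm_pos_iff.2 (sub_ne_zero.2 (hv.ne ho))
      refine ⟨-inner ℝ (T.coordGrad c + T.coordGrad d) v, ?_, ?_⟩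
      · rw [inner_add_left, neg_nonneg]
        have hface : ∀ {p q : Fin 4}, p ≠ a → p ≠ b → p ≠ q → (∀ m, m = a ∨ m = b ∨ m = p ∨ m = q) →
            T.coord p (γ r) = 0 → 0 < T.coord q (γ r) →
            T.coord q (γ r) < T.coord q (T.foot o p) →
            inner ℝ (T.coordGrad p) v + inner ℝ (T.coordGrad q) v ≤ 0 := by
          intro p q hpa hpb hpq hall hp hq hlt
          have hveq := hv.eq_of_face ho hp fun j hj hj0 => by
            rcases hall j with rfl | rfl | rfl | rfl
            exacts [absurd hj0 hna.ne', absurd hj0 hnb.ne', absurd rfl hj, absurd hj0 hq.ne']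
          rw [hveq, inner_smul_right, inner_smul_right, inner_coordGrad_sub, inner_coordGrad_sub,
            hp, coord_foot_self ho, sub_self, mul_zero, zero_add]
          exact mul_nonpos_of_nonneg_of_nonpos (by positivity) (by linarith)
        rcases (hbody r hrI hr0 c).eq_or_lt with hc0 | hc0
        · rcases (hbody r hrI hr0 d).eq_or_lt with hd0 | hd0
          · have hzero : ∀ i, i ≠ a → i ≠ b → T.coord i (γ r) = 0 := fun i h1 h2 => by
              rcases hlast i with rfl | rfl | rfl | rfl
              exacts [absurd rfl h1, absurd rfl h2, hc0.symm, hd0.symm]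
            have hveq := hv.eq_of_saddle_edge H.isEquilibrium H.ne hna hnb hzero H.coord_eq_zero
              (by rw [real_inner_comm]; exact H.inner_left)
              (by rw [real_inner_comm]; exact H.inner_right)
            rw [hveq, inner_smul_right, inner_smul_right, inner_coordGrad_sub,
              inner_coordGrad_sub, ← hc0, ← hd0, H.coord_eq_zero c hca hcb,
              H.coord_eq_zero d hda hdb]
            simp
          · exact hface hca hcb hcd hlast hc0.symm hd0 hnd
        · rcases (hbody r hrI hr0 d).eq_or_lt with hd0 | hd0
          · rw [add_comm]
            refine hface hda hdb hcd.symm (fun m => ?_) hd0.symm hc0 hnc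
            rcases hlast m with h | h | h | h <;> simp [h]
          · obtain ⟨-, m, hm⟩ := hv.2.1.exists_coord_eq_zero
            rcases hlast m with rfl | rfl | rfl | rfl
            exacts [absurd hm hna.ne', absurd hm hnb.ne', absurd hm hc0.ne', absurd hm hd0.ne']
      · rw [inner_add_left]
        exact ((hasDerivWithinAt_coord hd c).add (hasDerivWithinAt_coord hd d)).neg
  have hψ0 : T.coord c (γ t) + T.coord d (γ t) ≤ 0 := by
    refine le_of_forall_gt_imp_ge_of_dense fun ε hε => ?_
    have hcont : Continuous fun y => T.coord c y + T.coord d y :=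
      (T.continuous_coord c).add (T.continuous_coord d)
    have hev' : ∀ᶠ y in nhds h, T.coord c y + T.coord d y < ε :=
      hcont.continuousAt.eventually (gt_mem_nhds (by
        simp only
        rw [H.coord_eq_zero c hca hcb, H.coord_eq_zero d hda hdb, add_zero]; exact hε))
    obtain ⟨t₂, ht₂, h2⟩ := hγ.eventually hev'
    rcases le_total t₂ t with hle | hle
    · exact (hψ t₂ ht₂ hle).trans (h2 t₂ ht₂ le_rfl).le
    · exact (h2 t ht hle).le
  have hc0 := hbody t ht htle c
  have hd0 := hbody t ht htle d
  obtain ⟨hna, hnb, -⟩ := hnear t ht (htle.trans ht₀₁.le)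
  refine ⟨hna, hnb, fun i h1 h2 => ?_⟩
  rcases hlast i with rfl | rfl | rfl | rfl
  exacts [absurd rfl h1, absurd rfl h2, by linarith, by linarith]

/-- The initial part of a curve that leaves a saddle on the side of vertex `a` is an interval of
the edge; it is traversed monotonically. -/
lemma start_side (H : T.IsSaddleEdge o h a b) {I : Set ℝ} {γ : ℝ → E3}
    (hγ : T.IsCurveFrom o h I γ) {t₀ : ℝ} (ht₀ : t₀ ∈ I) (ht₀neg : t₀ < 0)
    (hedge : ∀ t ∈ I, t ≤ t₀ → 0 < T.coord a (γ t) ∧ 0 < T.coord b (γ t) ∧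
      ∀ i, i ≠ a → i ≠ b → T.coord i (γ t) = 0) (hside : T.coord a h < T.coord a (γ t₀)) :
    (∀ s ∈ Set.Ioc 0 (T.coord a (γ t₀) - T.coord a h), ∃ t ∈ I, t ≤ t₀ ∧
      T.coord a (γ t) - T.coord a h = s) ∧
    ∀ t ∈ I, t ≤ t₀ → γ '' (I ∩ Set.Iic t) =
      (fun s : ℝ => h + s • (T.points a - T.points b)) ''
        Set.Ioc 0 (T.coord a (γ t) - T.coord a h) := by
  have hcont : ∀ {r s}, r ∈ I → s ∈ I →
      ContinuousOn (fun t => T.coord a (γ t) - T.coord a h) (Set.Icc r s) := fun hr hs =>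
    ((T.continuous_coord a).comp_continuousOn (hγ.continuousOn.mono
      (hγ.ordConnected.out hr hs))).sub continuousOn_const
  have hne : ∀ t ∈ I, t ≤ t₀ → T.coord a (γ t) - T.coord a h ≠ 0 := by
    intro t ht hle h0
    obtain ⟨v, hv, -⟩ := hγ.deriv t ht (hle.trans_lt ht₀neg)
    have := H.eq_add_smul (hedge t ht hle).2.2
    rw [h0, zero_smul, add_zero] at this
    rw [this] at hv
    exact H.isEquilibrium.not_isExtendedGradient hv
  have hpos : ∀ t ∈ I, t ≤ t₀ → 0 < T.coord a (γ t) - T.coord a h := by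
    intro t ht hle
    by_contra! hneg
    obtain ⟨r, hr, hr0⟩ := intermediate_value_Icc hle (hcont ht ht₀)
      (show (0 : ℝ) ∈ Set.Icc _ _ from ⟨hneg, by linarith⟩)
    exact hne r (hγ.ordConnected.out ht ht₀ hr) hr.2 hr0
  have hmono : ∀ r ∈ I, ∀ s ∈ I, r ≤ s → s ≤ t₀ →
      T.coord a (γ r) - T.coord a h ≤ T.coord a (γ s) - T.coord a h := by
    intro r hr s hs hrs hst
    refine le_of_hasDerivWithinAt_right_nonneg (f := fun t => T.coord a (γ t) - T.coord a h) hrs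
      (hcont hr hs) fun t ht => ?_
    have htI := hγ.ordConnected.out hr hs ⟨ht.1, ht.2.le⟩
    have htle := ht.2.le.trans hst
    obtain ⟨v, hv, hd⟩ := hγ.deriv t htI (htle.trans_lt ht₀neg)
    obtain ⟨hna, hnb, hzero⟩ := hedge t htI htle
    have hveq := hv.eq_of_saddle_edge H.isEquilibrium H.ne hna hnb hzero H.coord_eq_zero
      (by rw [real_inner_comm]; exact H.inner_left) (by rw [real_inner_comm]; exact H.inner_right)
    refine ⟨inner ℝ (T.coordGrad a) v, ?_, (hasDerivWithinAt_coord hd a).sub_const _⟩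
    rw [hveq, inner_smul_right, inner_coordGrad_sub]
    exact mul_nonneg (by positivity) (hpos t htI htle).le
  have hsurj : ∀ t ∈ I, t ≤ t₀ → ∀ s ∈ Set.Ioc 0 (T.coord a (γ t) - T.coord a h), ∃ r ∈ I, r ≤ t ∧
      T.coord a (γ r) - T.coord a h = s := by
    intro t ht hle s hs
    have hev : ∀ᶠ y in nhds h, T.coord a y < T.coord a h + s :=
      (T.continuous_coord a).continuousAt.eventually (gt_mem_nhds (by linarith [hs.1]))
    obtain ⟨t₁, ht₁, h1⟩ := hγ.eventually hev
    obtain ⟨t₂, ht₂, h21, h2t⟩ : ∃ t₂ ∈ I, t₂ ≤ t₁ ∧ t₂ ≤ t := by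
      rcases le_total t₁ t with hle' | hle'
      exacts [⟨t₁, ht₁, le_rfl, hle'⟩, ⟨t, ht, hle', le_rfl⟩]
    have h2 : T.coord a (γ t₂) < T.coord a h + s := h1 t₂ ht₂ h21
    obtain ⟨r, hr, hrs⟩ := intermediate_value_Icc h2t (hcont ht₂ ht)
      (show s ∈ Set.Icc _ _ from ⟨by linarith, hs.2⟩)
    exact ⟨r, hγ.ordConnected.out ht₂ ht hr, hr.2, hrs⟩
  refine ⟨hsurj t₀ ht₀ le_rfl, fun t ht hle => ?_⟩
  ext z
  constructor
  · rintro ⟨r, ⟨hr, hrt⟩, rfl⟩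
    have hrt : r ≤ t := hrt
    exact ⟨_, ⟨hpos r hr (hrt.trans hle), hmono r hr t ht hrt hle⟩,
      (H.eq_add_smul (hedge r hr (hrt.trans hle)).2.2).symm⟩
  · rintro ⟨s, hs, rfl⟩
    obtain ⟨r, hr, hrt, rfl⟩ := hsurj t ht hle s hs
    exact ⟨r, ⟨hr, hrt⟩, H.eq_add_smul (hedge r hr (hrt.trans hle)).2.2⟩

/-- A curve that leaves a saddle on the side of vertex `a` meets no vertices but those at the end
of chains that start at `a`. -/
lemma reflTransGen_of_side (H : T.IsSaddleEdge o h a b) (ho : o ∈ interior T.body) {γ : ℝ → E3}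
    {t₀ t₁ : ℝ} (h01 : t₀ ≤ t₁) (hγ : T.IsAscendingOn o γ t₀ t₁)
    (hbody : γ t₀ ∈ T.body) (hpb : 0 < T.coord b (γ t₀))
    (hzero : ∀ i, i ≠ a → i ≠ b → T.coord i (γ t₀) = 0) (hside : T.coord a h < T.coord a (γ t₀))
    {m : Fin 4} (hm : γ t₁ = T.points m) :
    Relation.ReflTransGen (Leads fun m => T.points m - o) a m := by
  obtain ⟨c, hca, hcb⟩ := (by decide : ∀ i j : Fin 4, ∃ l, l ≠ i ∧ l ≠ j) a b
  obtain ⟨M, hM, haM, hMc⟩ := exists_trap_of_vertex ho a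
  set x := γ t₀ with hx
  set f := T.coord a x - T.coord a h with hf
  have hxh := H.eq_add_smul hzero
  have hsum : T.coord b x = 1 - T.coord a x := by
    have h1 := T.sum_coord x
    rw [← Finset.sum_subset (Finset.subset_univ {a, b}) fun i _ hi => by
      simp only [Finset.mem_insert, Finset.mem_singleton, not_or] at hi
      exact hzero i hi.1 hi.2, Finset.sum_pair H.ne] at h1
    linarith
  have h1x : 0 < 1 - T.coord a x := by linarith
  have hax : T.points a - x = (1 - T.coord a x) • (T.points a - T.points b) := by
    have := H.eq_add_smul (x := T.points a) fun i h1 h2 => T.coord_point_of_ne h1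
    rw [coord_point_self] at this
    conv_lhs => rw [this, hxh]
    module
  have htrap : T.IsTrap o (segment ℝ x (T.points a) ∪ M) := by
    refine hM.union_segment_of_normal haM hbody (ν := h - o) (β := f / (1 - T.coord a x))
      (div_nonneg (by linarith) h1x.le) ?_ ?_ (fun z hz => ?_) (hzero c hca hcb)
      (T.coord_point_of_ne hca)
    · rw [hax, smul_smul, div_mul_cancel₀ _ h1x.ne']
      conv_lhs => rw [hxh]
      abel
    · rw [hax, inner_smul_right, H.inner_edge, mul_zero]
    · have h1 := H.isEquilibrium.2.2 z hz
      rw [real_inner_comm] at h1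
      rw [hxh, show z - (h + f • (T.points a - T.points b)) =
        (z - h) - f • (T.points a - T.points b) by abel, inner_sub_right, inner_smul_right,
        H.inner_edge, mul_zero, sub_zero]
      exact h1
  have hmem := htrap.mem ho hγ (Or.inl (left_mem_segment ℝ _ _)) (t := t₁) ⟨h01, le_rfl⟩
  rw [hm] at hmem
  rcases hmem with hmem | hmem
  · have hlt : T.coord m x < 1 := by
      by_cases hma : m = a
      · rw [hma]; linarith
      by_cases hmb : m = b
      · have := T.coord_pos_of_mem_interior ho a
        have h0 := H.pos_left
        rw [hmb, hsum]; linarith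
      · rw [hzero m hma hmb]; exact one_pos
    rw [eq_of_point_mem_segment hmem hlt]
  · exact hMc m hmem

/-- Two curves that leave a saddle on the same side and end at the same vertex coincide. -/
lemma eq_of_same_side (H : T.IsSaddleEdge o h a b) (ho : o ∈ interior T.body) {I₁ I₂ : Set ℝ}
    {γ₁ γ₂ : ℝ → E3} (hγ₁ : T.IsCurveFrom o h I₁ γ₁) (hγ₂ : T.IsCurveFrom o h I₂ γ₂)
    (h01 : (0 : ℝ) ∈ I₁) (h02 : (0 : ℝ) ∈ I₂) (heq : γ₁ 0 = γ₂ 0) (hu : T.IsEquilibrium o (γ₁ 0))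
    {i : Fin 4} (hi : T.coord i (γ₁ 0) = 0) {t₁ t₂ : ℝ} (ht₁ : t₁ ∈ I₁) (ht₂ : t₂ ∈ I₂)
    (hneg₁ : t₁ < 0) (hneg₂ : t₂ < 0)
    (hedge₁ : ∀ t ∈ I₁, t ≤ t₁ → 0 < T.coord a (γ₁ t) ∧ 0 < T.coord b (γ₁ t) ∧
      ∀ i, i ≠ a → i ≠ b → T.coord i (γ₁ t) = 0)
    (hedge₂ : ∀ t ∈ I₂, t ≤ t₂ → 0 < T.coord a (γ₂ t) ∧ 0 < T.coord b (γ₂ t) ∧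
      ∀ i, i ≠ a → i ≠ b → T.coord i (γ₂ t) = 0)
    (hside₁ : T.coord a h < T.coord a (γ₁ t₁)) (hside₂ : T.coord a h < T.coord a (γ₂ t₂)) :
    γ₁ '' I₁ = γ₂ '' I₂ := by
  obtain ⟨hsurj₁, him₁⟩ := H.start_side hγ₁ ht₁ hneg₁ hedge₁ hside₁
  obtain ⟨hsurj₂, him₂⟩ := H.start_side hγ₂ ht₂ hneg₂ hedge₂ hside₂
  set s := min (T.coord a (γ₁ t₁) - T.coord a h) (T.coord a (γ₂ t₂) - T.coord a h) with hs
  have hs0 : 0 < s := lt_min (by linarith) (by linarith)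
  obtain ⟨r₁, hr₁, hle₁, hs₁⟩ := hsurj₁ s ⟨hs0, min_le_left _ _⟩
  obtain ⟨r₂, hr₂, hle₂, hs₂⟩ := hsurj₂ s ⟨hs0, min_le_right _ _⟩
  have hmeet : γ₁ r₁ = γ₂ r₂ := by
    rw [H.eq_add_smul (hedge₁ r₁ hr₁ hle₁).2.2, H.eq_add_smul (hedge₂ r₂ hr₂ hle₂).2.2, hs₁, hs₂]
  have hsplit : ∀ {I : Set ℝ} {γ : ℝ → E3} {r : ℝ}, T.IsCurveFrom o h I γ → (0 : ℝ) ∈ I → r ∈ I →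
      γ '' I = γ '' (I ∩ Set.Iic r) ∪ γ '' Set.Icc r 0 := by
    intro I γ r hγ h0 hr
    rw [← Set.image_union]
    congr 1
    ext t
    constructor
    · intro ht
      rcases le_total t r with hle | hle
      exacts [Or.inl ⟨ht, hle⟩, Or.inr ⟨hle, hγ.nonpos t ht⟩]
    · rintro (ht | ht)
      exacts [ht.1, hγ.ordConnected.out hr h0 ht]
  have hA₁ := hγ₁.isAscendingOn hr₁ h01
  have hA₂ := hγ₂.isAscendingOn hr₂ h02
  have hr₁0 : r₁ ≤ 0 := hγ₁.nonpos r₁ hr₁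
  have hr₂0 : r₂ ≤ 0 := hγ₂.nonpos r₂ hr₂
  rw [hsplit hγ₁ h01 hr₁, hsplit hγ₂ h02 hr₂, him₁ r₁ hr₁ hle₁, him₂ r₂ hr₂ hle₂, hs₁, hs₂]
  congr 1
  apply Set.Subset.antisymm
  · rintro _ ⟨t, ht, rfl⟩
    exact (hA₂.isTrap ho (heq ▸ hu) (heq ▸ hi)).mem ho hA₁
      ⟨r₂, ⟨le_rfl, hr₂0⟩, hmeet.symm⟩ ht
  · rintro _ ⟨t, ht, rfl⟩
    exact (hA₁.isTrap ho hu hi).mem ho hA₂ ⟨r₁, ⟨le_rfl, hr₁0⟩, hmeet⟩ ht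

/-- A curve that ends at a saddle arrives in the interior of one of the two adjacent faces. -/
lemma exists_arrival (H : T.IsSaddleEdge o h a b) {x : E3} {I : Set ℝ}
    {γ : ℝ → E3} (hγ : T.IsCurveFrom o x I γ) (h0 : (0 : ℝ) ∈ I) (hγ0 : γ 0 = h) :
    ∃ i, i ≠ a ∧ i ≠ b ∧ ∃ t₁ ∈ I, t₁ < 0 ∧ ∀ t ∈ Set.Ico t₁ 0, T.OnFace i (γ t) := by
  obtain ⟨c, d, hca, hcb, hda, hdb, hcd⟩ : ∃ c d, c ≠ a ∧ c ≠ b ∧ d ≠ a ∧ d ≠ b ∧ c ≠ d :=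
    (by decide : ∀ a b : Fin 4, a ≠ b → ∃ c d, c ≠ a ∧ c ≠ b ∧ d ≠ a ∧ d ≠ b ∧ c ≠ d) a b H.ne
  have hlast : ∀ m, m = a ∨ m = b ∨ m = c ∨ m = d := by have := H.ne; omega
  set τ := T.points a - T.points b with hτ
  have hτ0 : 0 < ‖τ‖ ^ 2 := by
    have := norm_pos_iff.2 (point_sub_ne (T := T) H.ne.symm)
    positivity
  obtain ⟨t₀, ht₀, ht₀neg⟩ := hγ.exists_lt 0 h0
  have hc0 : ContinuousOn γ (Set.Icc t₀ 0) :=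
    hγ.continuousOn.mono (hγ.ordConnected.out ht₀ h0)
  have hev : ∀ᶠ t in nhdsWithin (0 : ℝ) (Set.Iic 0), 0 < T.coord a (γ t) ∧ 0 < T.coord b (γ t) := by
    rw [← nhdsWithin_Icc_eq_nhdsLE ht₀neg]
    have hcw := hc0.continuousWithinAt (Set.right_mem_Icc.2 ht₀neg.le)
    refine (((T.continuous_coord a).continuousAt.comp_continuousWithinAt hcw).eventually
      (lt_mem_nhds ?_)).and
      (((T.continuous_coord b).continuousAt.comp_continuousWithinAt hcw).eventually (lt_mem_nhds ?_))
    · simpa [hγ0] using H.pos_left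
    · simpa [hγ0] using H.pos_right
  obtain ⟨t₂, ht₂, hpos⟩ := mem_nhdsLE_iff_exists_Icc_subset.1 hev
  set t₁ := max t₀ t₂ with ht₁
  have ht₁neg : t₁ < 0 := max_lt ht₀neg ht₂
  have ht₁I : t₁ ∈ I := hγ.ordConnected.out ht₀ h0 ⟨le_max_left _ _, ht₁neg.le⟩
  have hpos' : ∀ t ∈ Set.Icc t₁ 0, 0 < T.coord a (γ t) ∧ 0 < T.coord b (γ t) := fun t ht =>
    hpos ⟨(le_max_right t₀ t₂).trans ht.1, ht.2⟩
  have hIcc : ∀ t ∈ Set.Icc t₁ 0, t ∈ I := fun t ht => hγ.ordConnected.out ht₁I h0 ht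
  have hc1 : ContinuousOn γ (Set.Icc t₁ 0) := hγ.continuousOn.mono hIcc
  have hE0 : inner ℝ (h - o) τ = 0 := H.inner_edge
  -- the flow moves away from the plane through `o` perpendicular to the edge
  have hE : ∀ t ∈ Set.Ico t₁ 0, inner ℝ (γ t - o) τ = 0 := by
    intro t ht
    have hle := le_of_hasDerivWithinAt_right_nonneg (f := fun t => inner ℝ (γ t - o) τ ^ 2)
      ht.2.le ?_ fun s hs => ?_
    · rw [hγ0, hE0] at hle
      exact pow_eq_zero_iff two_ne_zero |>.1 (le_antisymm (by simpa using hle) (sq_nonneg _))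
    · exact (((hc1.mono (Set.Icc_subset_Icc_left ht.1)).sub continuousOn_const).inner
        continuousOn_const).pow 2
    · have hs' : s ∈ Set.Icc t₁ 0 := ⟨ht.1.trans hs.1, hs.2.le⟩
      obtain ⟨v, hv, hd⟩ := hγ.deriv s (hIcc s hs') hs.2
      have hdE : HasDerivWithinAt (fun t => inner ℝ (γ t - o) τ) (inner ℝ v τ) (Set.Ici s) s := by
        simpa using (hd.sub_const o).inner ℝ (hasDerivWithinAt_const s (Set.Ici s) τ)
      refine ⟨_, ?_, hdE.pow 2⟩
      rw [hv.inner_edge (hpos' s hs').1 (hpos' s hs').2]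
      have : 0 ≤ ‖γ s - o‖⁻¹ * (2 * inner ℝ (γ s - o) τ ^ 2) := by positivity
      convert this using 1
      simp only [Nat.cast_ofNat, Nat.add_one_sub_one, pow_one]
      ring
  have hdich : ∀ t ∈ Set.Ico t₁ 0, (T.OnFace c (γ t) ∨ T.OnFace d (γ t)) := by
    intro t ht
    have ht' : t ∈ Set.Icc t₁ 0 := ⟨ht.1, ht.2.le⟩
    obtain ⟨hta, htb⟩ := hpos' t ht'
    obtain ⟨v, hv, -⟩ := hγ.deriv t (hIcc t ht') ht.2
    obtain ⟨hbody, m, hm⟩ := hv.2.1.exists_coord_eq_zero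
    have hnn := T.mem_body_iff.1 hbody
    have hnot : ¬ (T.coord c (γ t) = 0 ∧ T.coord d (γ t) = 0) := by
      rintro ⟨h1, h2⟩
      have hγt := H.eq_add_smul (x := γ t) fun i hia hib => by
        rcases hlast i with rfl | rfl | rfl | rfl
        exacts [absurd rfl hia, absurd rfl hib, h1, h2]
      have h3 := hE t ht
      rw [hγt, show h + (T.coord a (γ t) - T.coord a h) • τ - o =
        (h - o) + (T.coord a (γ t) - T.coord a h) • τ by abel, inner_add_left, hE0,
        inner_smul_left, real_inner_self_eq_norm_sq, zero_add] at h3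
      have h4 : T.coord a (γ t) - T.coord a h = 0 := by
        simpa using (mul_eq_zero.1 h3).resolve_right hτ0.ne'
      rw [h4, zero_smul, add_zero] at hγt
      rw [hγt] at hv
      exact H.isEquilibrium.not_isExtendedGradient hv
    rcases (hnn c).eq_or_lt with hc | hc
    · refine Or.inl ⟨hc.symm, fun i hi => ?_⟩
      rcases hlast i with rfl | rfl | rfl | rfl
      exacts [hta, htb, absurd rfl hi, lt_of_le_of_ne (hnn _) fun h => hnot ⟨hc.symm, h.symm⟩]
    · have hd : T.coord d (γ t) = 0 := by
        rcases hlast m with rfl | rfl | rfl | rfl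
        exacts [absurd hm hta.ne', absurd hm htb.ne', absurd hm hc.ne', hm]
      refine Or.inr ⟨hd, fun i hi => ?_⟩
      rcases hlast i with rfl | rfl | rfl | rfl
      exacts [hta, htb, hc, absurd rfl hi]
  -- the curve cannot change from one face to the other
  have hsame : ∀ {p q : Fin 4}, p ≠ q →
      (∀ t ∈ Set.Ico t₁ 0, T.OnFace p (γ t) ∨ T.OnFace q (γ t)) → T.OnFace p (γ t₁) →
      ∀ t ∈ Set.Ico t₁ 0, T.OnFace p (γ t) := by
    intro p q hpq hd hp t ht
    rcases hd t ht with h | h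
    · exact h
    exfalso
    have hcont : ContinuousOn (fun t => T.coord p (γ t) - T.coord q (γ t)) (Set.Icc t₁ t) :=
      ((T.continuous_coord p).comp_continuousOn (hc1.mono (Set.Icc_subset_Icc_right ht.2.le))).sub
        ((T.continuous_coord q).comp_continuousOn (hc1.mono (Set.Icc_subset_Icc_right ht.2.le)))
    have h1 : T.coord p (γ t₁) - T.coord q (γ t₁) ≤ 0 := by
      rw [hp.1]; linarith [hp.2 q hpq.symm]
    have h2 : 0 ≤ T.coord p (γ t) - T.coord q (γ t) := by
      rw [h.1]; linarith [h.2 p hpq]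
    obtain ⟨r, hr, hr0⟩ := intermediate_value_Icc ht.1 hcont (show (0 : ℝ) ∈ Set.Icc _ _ from ⟨h1, h2⟩)
    have hr0 : T.coord p (γ r) - T.coord q (γ r) = 0 := hr0
    rcases hd r ⟨hr.1, hr.2.trans_lt ht.2⟩ with h | h
    · have := h.2 q hpq.symm; rw [h.1] at hr0; linarith
    · have := h.2 p hpq; rw [h.1] at hr0; linarith
  rcases hdich t₁ ⟨le_rfl, ht₁neg⟩ with h1 | h1
  · exact ⟨c, hca, hcb, t₁, ht₁I, ht₁neg, hsame hcd hdich h1⟩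
  · exact ⟨d, hda, hdb, t₁, ht₁I, ht₁neg, hsame hcd.symm (fun t ht => (hdich t ht).symm) h1⟩

/-- A curve that leaves a saddle starts inside the edge, on one of the two sides of the saddle. -/
lemma exists_side (H : T.IsSaddleEdge o h a b) (ho : o ∈ interior T.body)
    {I : Set ℝ} {γ : ℝ → E3} (hγ : T.IsCurveFrom o h I γ) :
    ∃ t₀ ∈ I, t₀ < 0 ∧ (∀ t ∈ I, t ≤ t₀ → 0 < T.coord a (γ t) ∧ 0 < T.coord b (γ t) ∧
      ∀ i, i ≠ a → i ≠ b → T.coord i (γ t) = 0) ∧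
      (T.coord a h < T.coord a (γ t₀) ∨ T.coord b h < T.coord b (γ t₀)) := by
  obtain ⟨t₀, ht₀, hneg, hedge⟩ := H.exists_start ho hγ
  refine ⟨t₀, ht₀, hneg, hedge, ?_⟩
  by_contra! hcon
  have hab : ∀ y, (∀ i, i ≠ a → i ≠ b → T.coord i y = 0) → T.coord a y + T.coord b y = 1 := by
    intro y hy
    have h1 := T.sum_coord y
    rwa [← Finset.sum_subset (Finset.subset_univ {a, b}) fun i _ hi => by
      simp only [Finset.mem_insert, Finset.mem_singleton, not_or] at hi
      exact hy i hi.1 hi.2, Finset.sum_pair H.ne] at h1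
  obtain ⟨v, hv, -⟩ := hγ.deriv t₀ ht₀ hneg
  have hz := (hedge t₀ ht₀ le_rfl).2.2
  have h1 := H.eq_add_smul hz
  have h2 := hab _ hz
  have h3 := hab _ H.coord_eq_zero
  rw [show T.coord a (γ t₀) - T.coord a h = 0 by linarith [hcon.1, hcon.2], zero_smul,
    add_zero] at h1
  rw [h1] at hv
  exact H.isEquilibrium.not_isExtendedGradient hv

end IsSaddleEdge

end Tetrahedron

theorem lemma2 (T : Tetrahedron) (o : E3) (ho : o ∈ interior T.body)
    (hMorse : T.IsPolyhedralMorse o) (hns : ¬ T.IsMonostatic o) :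
    (∀ h u : E3, T.IsSaddle o h → T.IsUnstable o u →
      ∀ C₁ C₂ : Set E3, T.IsIsolatedAscendingCurve o h u C₁ →
        T.IsIsolatedAscendingCurve o h u C₂ → C₁ = C₂) ∧
    (∀ s h : E3, T.IsStable o s → T.IsSaddle o h →
      ∀ C₁ C₂ : Set E3, T.IsIsolatedAscendingCurve o s h C₁ →
        T.IsIsolatedAscendingCurve o s h C₂ →
        (∀ i, T.points i ∉ C₁) → (∀ i, T.points i ∉ C₂) → C₁ = C₂) := by
  constructor
  · rintro h u hh hu C₁ C₂ ⟨hC₁, -⟩ ⟨hC₂, -⟩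
    obtain ⟨a, b, H⟩ := hh.exists_edge
    obtain ⟨m, hum, hmtop⟩ := hu.exists_vertex
    obtain ⟨-, hueq, I₁, γ₁, hγ₁, h01, hend₁, rfl⟩ := hC₁.exists_isCurveFrom
    obtain ⟨-, -, I₂, γ₂, hγ₂, h02, hend₂, rfl⟩ := hC₂.exists_isCurveFrom
    obtain ⟨t₁, ht₁, hneg₁, hedge₁, hside₁⟩ := H.exists_side ho hγ₁
    obtain ⟨t₂, ht₂, hneg₂, hedge₂, hside₂⟩ := H.exists_side ho hγ₂
    have hui : T.coord (m + 1) (γ₁ 0) = 0 := by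
      rw [hend₁, hum]; exact T.coord_point_of_ne (by simp)
    have hswap₁ : ∀ t ∈ I₁, t ≤ t₁ → 0 < T.coord b (γ₁ t) ∧ 0 < T.coord a (γ₁ t) ∧
        ∀ i, i ≠ b → i ≠ a → T.coord i (γ₁ t) = 0 := fun t ht hle =>
      ⟨(hedge₁ t ht hle).2.1, (hedge₁ t ht hle).1, fun i h1 h2 => (hedge₁ t ht hle).2.2 i h2 h1⟩
    have hswap₂ : ∀ t ∈ I₂, t ≤ t₂ → 0 < T.coord b (γ₂ t) ∧ 0 < T.coord a (γ₂ t) ∧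
        ∀ i, i ≠ b → i ≠ a → T.coord i (γ₂ t) = 0 := fun t ht hle =>
      ⟨(hedge₂ t ht hle).2.1, (hedge₂ t ht hle).1, fun i h1 h2 => (hedge₂ t ht hle).2.2 i h2 h1⟩
    -- curves that leave on different sides end at different vertices
    have hopp : ¬ (Relation.ReflTransGen (Leads fun m => T.points m - o) a m ∧
        Relation.ReflTransGen (Leads fun m => T.points m - o) b m) := by
      rintro ⟨ha, hb⟩
      refine hns (Or.inr ⟨u, hu, fun u' hu' => ?_⟩)
      obtain ⟨m', hum', hmtop'⟩ := hu'.exists_vertex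
      by_cases hmm : m' = m
      · rw [hum', hmm, hum]
      · obtain ⟨j, hj⟩ := H.exists_leads_vertices ha hb m' hmm
        exact absurd hj (hmtop' j)
    have chain : ∀ {I : Set ℝ} {γ : ℝ → E3} {t : ℝ} {a b : Fin 4}, T.IsSaddleEdge o h a b →
        T.IsCurveFrom o h I γ → (0 : ℝ) ∈ I → γ 0 = u → t ∈ I → t < 0 →
        (0 < T.coord a (γ t) ∧ 0 < T.coord b (γ t) ∧
          ∀ i, i ≠ a → i ≠ b → T.coord i (γ t) = 0) → T.coord a h < T.coord a (γ t) →
        Relation.ReflTransGen (Leads fun m => T.points m - o) a m := by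
      intro I γ t a b H hγ h0 hend ht hneg hedge hside
      obtain ⟨v, hv, -⟩ := hγ.deriv t ht hneg
      exact H.reflTransGen_of_side ho hneg.le (hγ.isAscendingOn ht h0)
        hv.2.1.exists_coord_eq_zero.1 hedge.2.1 hedge.2.2 hside (hend.trans hum)
    rcases hside₁ with hs₁ | hs₁ <;> rcases hside₂ with hs₂ | hs₂
    · exact H.eq_of_same_side ho hγ₁ hγ₂ h01 h02 (hend₁.trans hend₂.symm) (hend₁ ▸ hueq) hui
        ht₁ ht₂ hneg₁ hneg₂ hedge₁ hedge₂ hs₁ hs₂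
    · exact absurd ⟨chain H hγ₁ h01 hend₁ ht₁ hneg₁ (hedge₁ t₁ ht₁ le_rfl) hs₁,
        chain H.symm hγ₂ h02 hend₂ ht₂ hneg₂ (hswap₂ t₂ ht₂ le_rfl) hs₂⟩ hopp
    · exact absurd ⟨chain H hγ₂ h02 hend₂ ht₂ hneg₂ (hedge₂ t₂ ht₂ le_rfl) hs₂,
        chain H.symm hγ₁ h01 hend₁ ht₁ hneg₁ (hswap₁ t₁ ht₁ le_rfl) hs₁⟩ hopp
    · exact H.symm.eq_of_same_side ho hγ₁ hγ₂ h01 h02 (hend₁.trans hend₂.symm) (hend₁ ▸ hueq) hui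
        ht₁ ht₂ hneg₁ hneg₂ hswap₁ hswap₂ hs₁ hs₂
  · rintro s h hs hh C₁ C₂ ⟨hC₁, -⟩ ⟨hC₂, -⟩ hv₁ hv₂
    obtain ⟨a, b, H⟩ := hh.exists_edge
    obtain ⟨l, hsl, hl⟩ := hs.exists_foot ho
    -- trace both curves backwards from the saddle
    have path : ∀ {C : Set E3}, T.IsAscendingCurve o s h C → (∀ i, T.points i ∉ C) →
        ∃ i, i ≠ a ∧ i ≠ b ∧ T.BackPath o i h C l := by
      intro C hC hv
      obtain ⟨-, -, I, γ, hγ, h0, hend, rfl⟩ := hC.exists_isCurveFrom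
      obtain ⟨i, hia, hib, t₁, ht₁, hneg, hface⟩ := H.exists_arrival hγ h0 hend
      obtain ⟨N, hN, rfl⟩ := hγ.exists_backPath ho hsl hl
        (fun t ht m heq => hv m ⟨t, ht, heq⟩) i 0 h0 ⟨t₁, ht₁, hneg, hface⟩
      have hI0 : I ∩ Set.Iic 0 = I :=
        Set.inter_eq_left.2 fun t ht => Set.mem_Iic.2 (hγ.nonpos t ht)
      rw [hend, hI0] at hN
      exact ⟨i, hia, hib, hN⟩
    obtain ⟨i, hia, hib, hi⟩ := path hC₁ hv₁
    obtain ⟨j, hja, hjb, hj⟩ := path hC₂ hv₂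
    by_cases hij : i = j
    · subst hij
      exact hi.unique hj
    · exfalso
      obtain ⟨k, p, q, hp, hq, h1, h2, h3, h4⟩ := H.polar_edge ho hia hib hja hjb hij
      have hall := exists_leads_of_chains hij hp hq h1 h2 h3 h4 hi.reflTransGen hj.reflTransGen
      refine hns (Or.inl ⟨s, hs, fun s' hs' => ?_⟩)
      obtain ⟨l', hsl', hl'⟩ := hs'.exists_foot ho
      by_cases hll : l' = l
      · rw [hsl', hll, hsl]
      · obtain ⟨m, hm⟩ := hall l' hll
        have hneg := (Tetrahedron.coord_foot_neg_iff ho l' m).2 hm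
        rw [← hsl'] at hneg
        exact absurd hneg (not_lt.2 (hl'.2 m hm.ne).le)
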